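/- **Setting.** Let either $E=\mathbb Z$ and $K$ a field of characteristic $0$ (discrete case), or $E=\mathbb R$ and $K=\mathbb C$ (continuous case). The Roman factorial is $\lfloor a\rceil!=\Gamma(a+1)$ if $a\in E$ is not a negative integer and $\lfloor a\rceil!=(-1)^{a+1}/(-a-1)!$ if it is. For a finitely supported integer sequence $\alpha=(\alpha_0,\alpha_1,\dots)$ let $\ell^\alpha=(\log x)^{\alpha_0}(\log\log x)^{\alpha_1}\cdots$; the harmonic logarithms are $\lambda_a^\alpha(x)=\lfloor a\rceil!\,x^a\sum_{k\ge0}s_k(a)\,(x\tfrac{d}{dx})^k\ell^\alpha$, where $\Gamma(1+y)/\Gamma(1+a+y)=\sum_k s_k(a)y^k$. $\mathcal I^\alpha$ is the space of series $\sum_a c_a\lambda_a^\alpha$ with, for every $b$, only finitely many $c_a\neq0$ with $a\ge b$. An Artinian operator is a series $f(D)=\sum_b f_bD^b$ with, for every $b$, only finitely many $f_a\ne0$ with $a\le b$; these form a field $\Lambda^+$, acting on $\mathcal I^\alpha$, $\alpha\ne(0)$, by $D^b\lambda_a^\alpha=\frac{\lfloor a\rceil!}{\lfloor a-b\rceil!}\lambda_{a-b}^\alpha$.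 A delta operator is an Artinian operator whose lowest nonzero term is $cD^1$. For $\alpha\ne(0)$ let $\langle p\rangle_\alpha$ be the coefficient of $\lambda_0^\alpha$ in $p\in\mathcal I^\alpha$. In the continuous case, for $f=cD(1+w)$ with $c\neq0$, $w$ of positive degree, and $n\in\mathbb Z$, put $f^{a;n}=e^{a(\operatorname{Log}c+2\pi i n)}D^a\sum_j\binom aj w^j$, $a\in\mathbb R$. A *graded sequence* is a family $p_a^\alpha=\sum_b d_{ab}\lambda_b^\alpha\in\mathcal I^\alpha$ with coefficients independent of $\alpha$, with $d_{aa}\ne0$ and $d_{ab}=0$ for $b>a$, such that for all $b,M$ only finitely many $a\le M$ have $d_{ab}\neq0$, and, in the continuous case, $a\mapsto\sum_b\varphi(b)\,d_{ab}\lfloor b\rceil!/\lfloor a\rceil!$ is continuous for every continuous $\varphi:\mathbb R\to\mathbb C$ vanishing near $-\infty$. It is a *Roman graded sequence* if for all $f,g\in\Lambda^+$, $\alpha\neq(0)$ and $a$ $$\langle f(D)g(D)p_a^\alpha\rangle_\alpha=\sum_b\frac{\lfloor a\rceil!}{\lfloor b\rceil!\,\lfloor a-b\rceil!}\langle f(D)p_b^\alpha\rangle_\alpha\langle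 g(D)p_{a-b}^\alpha\rangle_\alpha .$$ It is the *associated* sequence of a delta operator $f$ (discrete), resp. its *$n$-th associated* sequence (continuous), if $\langle f^bp_a^\alpha\rangle_\alpha=\lfloor a\rceil!\,\delta_{ab}$, resp. $\langle f^{b;n}p_a^\alpha\rangle_\alpha=\lfloor a\rceil!\,\delta_{ab}$, for all $a,b$ and $\alpha\ne(0)$. Let $\mathcal J$ be a linear space of formal combinations of the monomials $x^a\ell^\beta$ that contains $\mathcal I^\alpha$ for all $\alpha\ne(0)$ (for instance the logarithmic algebra $\mathcal I$, or $\mathcal I^+$). A linear $\tau:\mathcal J\to\mathcal J$ is *continuous* if for every $b$ there is $c$ such that $\tau$ maps series of degree $<c$ in $x$ to series of degree $<b$. Below, $\tau p_a^\alpha=q_a^\alpha$ is meant for all $a$ and all $\alpha$ with $\mathcal I^\alpha\subseteq\mathcal J$. A *transfer operator* is a continuous linear $\tau$ with $\tau\lambda_a^\alpha=p_a^\alpha$ for some Roman graded sequence $p$. The *adjoint* of $\tau$ is the linear $\tau^*:\Lambda^+\to\Lambda^+$ with $\langle[\tau^*f(D)]p\rangle_\alpha=\langle f(D)\,\tau p\rangle_\alpha$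 for all $\alpha\neq(0)$, $p\in\mathcal I^\alpha$, $f\in\Lambda^+$ (where $\tau\mathcal I^\alpha\subseteq\mathcal I^\alpha$). **Proposition.** In both cases: 1. If $\tau$ is a transfer operator and $q$ a Roman graded sequence, then $\tau q_a^\alpha=r_a^\alpha$ for a Roman graded sequence $r$. 2. Let $\tau$ be continuous and linear with $\tau p_a^\alpha=q_a^\alpha$, where $p$ and $q$ are the associated sequences (in the continuous case: the $n$-th and the $m$-th associated sequence, respectively) of delta operators $f(D)$ and $g(D)$. Then $\tau$ maps each $\mathcal I^\alpha$, $\alpha\neq(0)$, to itself, has a unique adjoint $\tau^*$, and $\tau^*g(D)=f(D)$. 3. In the situation of 2, $\tau^*\big(g(D)^{a;m}\big)=f(D)^{a;n}$ for all real $a$ in the continuous case, and $\tau^*(g(D)^a)=f(D)^a$ for all integers $a$ in the discrete case. Moreover $\tau$ is a transfer operator (in the continuous case in particular when both sequences are standard). -/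

import Mathlib

set_option linter.unusedSectionVars false

noncomputable section

/-! ## Exponents: Roman factorials and Stirling numbers -/

/-- The data attached to the set `E` of exponents of `x` (`ℤ` in the discrete case, `ℝ` in the
continuous case): the Roman factorial `⌊a⌉!`, the Stirling numbers, i.e. the coefficient of `y ^ k`
in the expansion at `y = 0` of `Γ(1 + y) / Γ(1 + a + y)`, and the notion of continuity for
functions of the exponent (no condition at all in the discrete case).
Only the two instances below are used. -/
class ExponentSystem (E K : Type*) [Field K] where
  fact : E → K
  stirling : E → ℕ → K
  Cont : (E → K) → Prop
  fact_ne_zero : ∀ a, fact a ≠ 0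
  stirling_ne_zero : ∀ a, stirling a 0 ≠ 0 ∨ stirling a 1 ≠ 0

/-- Roman factorial of an integer: `n!` for `n ≥ 0` and `(-1)^(n+1) / (-n-1)!` for `n < 0`. -/
def romanFactInt (K : Type*) [Field K] : ℤ → K
  | Int.ofNat n => (n.factorial : K)
  | Int.negSucc n => (-1) ^ n / (n.factorial : K)

/-- Coefficient of `y ^ k` in `Γ(1 + y) / Γ(1 + a + y)` for an integer `a`, which is
`1 / ((y + 1) ⋯ (y + n))` for `a = n ≥ 0` and `y (y - 1) ⋯ (y - m + 1)` for `a = -m < 0`. -/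
def romanStirlingInt (K : Type*) [Field K] : ℤ → ℕ → K
  | Int.ofNat n, k =>
      PowerSeries.coeff k
        (∏ j ∈ Finset.range n, (PowerSeries.X + PowerSeries.C ((j : K) + 1)))⁻¹
  | Int.negSucc n, k =>
      PowerSeries.coeff k
        (∏ j ∈ Finset.range (n + 1), (PowerSeries.X - PowerSeries.C (j : K)))

open Classical in
/-- Roman factorial of a real number: `Γ(a + 1)`, unless `a` is a negative integer, where it is
`(-1)^(a+1) / (-a-1)!`. -/
def romanFactReal (a : ℝ) : ℝ :=
  if ∃ n : ℤ, n < 0 ∧ (n : ℝ) = a then romanFactInt ℝ ⌊a⌋ else Real.Gamma (a + 1)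

/-- Coefficient of `y ^ k` in the Taylor expansion at `0` of `Γ(1 + y) / Γ(1 + a + y)`
(Mathlib's value `Γ = 0` at the poles is the right one for the entire function `1 / Γ`). -/
def romanStirlingReal (a : ℝ) (k : ℕ) : ℂ :=
  iteratedDeriv k (fun y : ℂ => Complex.Gamma (1 + y) * (Complex.Gamma (1 + a + y))⁻¹) 0
    / (k.factorial : ℂ)

theorem romanFactInt_ne_zero (K : Type*) [Field K] [CharZero K] (n : ℤ) :
    romanFactInt K n ≠ 0 := by
  cases n with
  | ofNat n => simp [romanFactInt, Nat.factorial_ne_zero]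
  | negSucc n => simp [romanFactInt, Nat.factorial_ne_zero]

theorem romanStirlingInt_ne_zero (K : Type*) [Field K] [CharZero K] (n : ℤ) :
    romanStirlingInt K n 0 ≠ 0 ∨ romanStirlingInt K n 1 ≠ 0 := by
  cases n with
  | ofNat n =>
    left
    simp only [romanStirlingInt, PowerSeries.coeff_zero_eq_constantCoeff, ne_eq,
      PowerSeries.constantCoeff_inv, inv_eq_zero, map_prod, map_add, PowerSeries.constantCoeff_X,
      PowerSeries.constantCoeff_C, zero_add, Finset.prod_eq_zero_iff, not_exists, not_and]
    intro j _
    exact Nat.cast_add_one_ne_zero j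
  | negSucc n =>
    right
    simp only [romanStirlingInt]
    rw [Finset.prod_range_succ', mul_comm]
    simp only [Nat.cast_zero, map_zero, sub_zero]
    rw [show (1 : ℕ) = 0 + 1 from rfl, PowerSeries.coeff_succ_X_mul,
      PowerSeries.coeff_zero_eq_constantCoeff, map_prod, Finset.prod_ne_zero_iff]
    intro j _
    simp only [map_sub, PowerSeries.constantCoeff_X, PowerSeries.constantCoeff_C, zero_sub]
    exact neg_ne_zero.2 (Nat.cast_ne_zero.2 (Nat.succ_ne_zero j))

theorem romanFactReal_ne_zero (a : ℝ) : romanFactReal a ≠ 0 := by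
  unfold romanFactReal
  split_ifs with h
  · exact romanFactInt_ne_zero ℝ _
  · apply Real.Gamma_ne_zero
    intro m hm
    apply h
    refine ⟨-(m : ℤ) - 1, by omega, ?_⟩
    push_cast
    linarith

theorem deriv_inv_Gamma_ne_zero (m : ℕ) :
    deriv (fun s : ℂ => (Complex.Gamma s)⁻¹) (-(m : ℂ)) ≠ 0 := by
  have key : ∀ s : ℂ, deriv (fun s : ℂ => (Complex.Gamma s)⁻¹) s =
      (Complex.Gamma (s + 1))⁻¹ + s * deriv (fun s : ℂ => (Complex.Gamma s)⁻¹) (s + 1) := by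
    intro s
    have h1 : (fun s : ℂ => (Complex.Gamma s)⁻¹) = fun s => s * (Complex.Gamma (s + 1))⁻¹ := by
      funext s
      exact Complex.one_div_Gamma_eq_self_mul_one_div_Gamma_add_one s
    have h2 : HasDerivAt (fun s : ℂ => (Complex.Gamma (s + 1))⁻¹)
        (deriv (fun s : ℂ => (Complex.Gamma s)⁻¹) (s + 1)) s :=
      HasDerivAt.comp_add_const s 1
        (Complex.differentiable_one_div_Gamma (s + 1)).hasDerivAt
    have h3 := (hasDerivAt_id s).mul h2
    conv_lhs => rw [h1]
    rw [show (fun s : ℂ => s * (Complex.Gamma (s + 1))⁻¹) =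
      id * (fun s : ℂ => (Complex.Gamma (s + 1))⁻¹) from rfl, h3.deriv]
    simp
  induction m with
  | zero => rw [key]; simp
  | succ m ih =>
    rw [key]
    have e : (-((m + 1 : ℕ) : ℂ) + 1) = -(m : ℂ) := by push_cast; ring
    rw [e, Complex.Gamma_neg_nat_eq_zero]
    simp only [inv_zero, zero_add]
    refine mul_ne_zero (neg_ne_zero.2 ?_) ih
    exact_mod_cast Nat.succ_ne_zero m

theorem romanStirlingReal_ne_zero (a : ℝ) :
    romanStirlingReal a 0 ≠ 0 ∨ romanStirlingReal a 1 ≠ 0 := by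
  by_cases h : Complex.Gamma (1 + a) = 0
  · right
    obtain ⟨m, hm⟩ := (Complex.Gamma_eq_zero_iff _).1 h
    have hd : HasDerivAt (fun y : ℂ => (Complex.Gamma (1 + a + y))⁻¹)
        (deriv (fun s : ℂ => (Complex.Gamma s)⁻¹) (1 + a + 0)) 0 :=
      HasDerivAt.comp_const_add (1 + (a : ℂ)) 0
        (Complex.differentiable_one_div_Gamma _).hasDerivAt
    have hg : HasDerivAt (fun y : ℂ => Complex.Gamma (1 + y))
        (deriv Complex.Gamma (1 + 0)) 0 := by
      refine HasDerivAt.comp_const_add (1 : ℂ) 0 (DifferentiableAt.hasDerivAt ?_)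
      apply Complex.differentiableAt_Gamma
      intro k hk
      have := congrArg Complex.re hk
      simp at this
      linarith [(Nat.cast_nonneg k : (0 : ℝ) ≤ k)]
    have := (hg.mul hd).deriv
    unfold romanStirlingReal
    rw [iteratedDeriv_one]
    have e : (fun y : ℂ => Complex.Gamma (1 + y) * (Complex.Gamma (1 + a + y))⁻¹) =
      (fun y : ℂ => Complex.Gamma (1 + y)) * (fun y : ℂ => (Complex.Gamma (1 + a + y))⁻¹) := rfl
    rw [e, this]
    simp only [add_zero, hm, Complex.Gamma_one, Complex.Gamma_neg_nat_eq_zero]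
    simpa using deriv_inv_Gamma_ne_zero m
  · left
    simp [romanStirlingReal, h]

instance intExponents (K : Type*) [Field K] [CharZero K] : ExponentSystem ℤ K where
  fact := romanFactInt K
  stirling := romanStirlingInt K
  Cont := fun _ => True
  fact_ne_zero := romanFactInt_ne_zero K
  stirling_ne_zero := romanStirlingInt_ne_zero K

instance realExponents : ExponentSystem ℝ ℂ where
  fact := fun a => (romanFactReal a : ℂ)
  stirling := romanStirlingReal
  Cont := fun φ => Continuous φ
  fact_ne_zero := fun a => Complex.ofReal_ne_zero.2 (romanFactReal_ne_zero a)
  stirling_ne_zero := romanStirlingReal_ne_zero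

/-! ## Iterated logarithms and harmonic logarithms -/

/-- The order `α = (α₀, α₁, …)` of the monomial
`ℓ^α = (log x)^α₀ (log log x)^α₁ ⋯` (finitely many nonzero integer exponents). -/
abbrev LogOrder : Type := ℕ →₀ ℤ

/-- The order with entries `1` at `0, …, i` and `0` elsewhere. -/
def initOnes (i : ℕ) : LogOrder := ∑ j ∈ Finset.range (i + 1), Finsupp.single j 1

/-- The derivation `x d/dx` on linear combinations of the monomials `ℓ^α`:
`x d/dx ℓ^α = ∑_i α_i ℓ^(α - (1, …, 1, 0, …))` with `1` in the places `0, …, i`. -/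
def logDer (K : Type*) [Field K] : (LogOrder →₀ K) →ₗ[K] (LogOrder →₀ K) :=
  Finsupp.linearCombination K fun α : LogOrder =>
    ∑ i ∈ α.support, Finsupp.single (α - initOnes i) ((α i : ℤ) : K)

/-- Formal expressions in `x` and its iterated logarithms: the value at `(a, β)` is the coefficient
of the monomial `x^a ℓ^β`. -/
abbrev LogExpr (E K : Type*) : Type _ := E → LogOrder → K

section Harmonic

variable {E K : Type*} [Field K] [ExponentSystem E K]

/-- The Roman factorial `⌊a⌉!`. -/
def rfact (K : Type*) {E : Type*} [Field K] [ExponentSystem E K] (a : E) : K :=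
  ExponentSystem.fact a

/-- The coefficient of `x^a ℓ^β` in the harmonic logarithm
`λ_a^α = ⌊a⌉! x^a ∑_k s_k(a) (x d/dx)^k ℓ^α`, where `s_k(a)` is the `k`-th Stirling number of `a`.
(For given `α`, `β`, at most one summand is nonzero.) -/
def logPart (K : Type*) {E : Type*} [Field K] [ExponentSystem E K]
    (a : E) (α β : LogOrder) : K :=
  rfact K a * ∑ᶠ k : ℕ, (ExponentSystem.stirling a k : K) *
    ((logDer K ^ k) (Finsupp.single α 1)) β

open Classical in
/-- The harmonic logarithm `λ_a^α(x)`. -/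
def harmonicLog (K : Type*) {E : Type*} [Field K] [ExponentSystem E K]
    (a : E) (α : LogOrder) : LogExpr E K :=
  fun a' β => if a' = a then logPart K a α β else 0

variable [LinearOrder E]

variable (E K) in
/-- Noetherian coefficient families: for every `b`, only finitely many `a ≥ b` have a nonzero
coefficient. -/
def Noeth : Submodule K (E → K) where
  carrier := {c | ∀ b, {a | b ≤ a ∧ c a ≠ 0}.Finite}
  zero_mem' := by intro b; simp
  add_mem' := by
    intro c d hc hd b
    refine ((hc b).union (hd b)).subset ?_
    rintro a ⟨ha, h⟩
    by_cases h0 : c a = 0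
    · right; refine ⟨ha, ?_⟩; intro h1; apply h; simp [h0, h1]
    · left; exact ⟨ha, h0⟩
  smul_mem' := by
    intro r c hc b
    refine (hc b).subset ?_
    rintro a ⟨ha, h⟩
    refine ⟨ha, ?_⟩
    intro h1; apply h; simp [h1]

/-- The formal power series of logarithmic type `∑_a c_a λ_a^α` with Noetherian coefficients `c`.
(The harmonic logarithm `λ_a^α` only involves monomials with the power `x^a`.) -/
def logSeries (α : LogOrder) : Noeth E K →ₗ[K] LogExpr E K where
  toFun c := fun a β => (c : E → K) a * logPart K a α β
  map_add' c d := by funext a β; simp [add_mul]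
  map_smul' r c := by funext a β; simp [mul_assoc]

variable (E K) in
/-- The space `I^α` of the series `∑_a c_a λ_a^α`. -/
def LogSpace (α : LogOrder) : Submodule K (LogExpr E K) := LinearMap.range (logSeries α)

theorem initOnes_apply (i j : ℕ) : initOnes i j = if j ≤ i then 1 else 0 := by
  simp [initOnes, Finsupp.finsetSum_apply, Finsupp.single_apply]

theorem logDer_single (α : LogOrder) (r : K) :
    logDer K (Finsupp.single α r) =
      ∑ i ∈ α.support, Finsupp.single (α - initOnes i) (r * ((α i : ℤ) : K)) := by
  simp [logDer, Finsupp.linearCombination_single, Finset.smul_sum]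

theorem logDer_pow_apply_ne_zero (α : LogOrder) (k : ℕ) (β : LogOrder)
    (h : ((logDer K ^ k) (Finsupp.single α 1)) β ≠ 0) : β 0 + k = α 0 := by
  induction k generalizing β with
  | zero =>
    simp only [pow_zero, Module.End.one_apply, Finsupp.single_apply] at h
    split_ifs at h with h1
    · simp [h1]
    · exact absurd rfl h
  | succ k ih =>
    rw [pow_succ', Module.End.mul_apply] at h
    set g := (logDer K ^ k) (Finsupp.single α 1) with hg
    have h1 : logDer K g = ∑ γ ∈ g.support, g γ •
        ∑ i ∈ γ.support, Finsupp.single (γ - initOnes i) ((γ i : ℤ) : K) := by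
      simp [logDer, Finsupp.linearCombination_apply, Finsupp.sum]
    rw [h1, Finsupp.finsetSum_apply] at h
    obtain ⟨γ, hγ, h2⟩ := Finset.exists_ne_zero_of_sum_ne_zero h
    rw [Finsupp.smul_apply, Finsupp.finsetSum_apply, Finset.smul_sum] at h2
    obtain ⟨i, hi, h3⟩ := Finset.exists_ne_zero_of_sum_ne_zero h2
    have h4 : γ - initOnes i = β := by
      by_contra hne
      apply h3
      simp [hne]
    have h5 := ih γ (Finsupp.mem_support_iff.1 hγ)
    rw [← h4]
    simp only [Finsupp.coe_sub, Pi.sub_apply, initOnes_apply, zero_le, if_true]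
    push_cast
    linarith

theorem initOnes_injective : Function.Injective initOnes := by
  intro i j h
  have h1 := DFunLike.congr_fun h i
  have h2 := DFunLike.congr_fun h j
  simp only [initOnes_apply, le_refl, if_true] at h1 h2
  apply le_antisymm
  · by_contra h3; simp [h3] at h1
  · by_contra h3; simp [h3] at h2

theorem exists_logPart_ne_zero [CharZero K] (a : E) (α : LogOrder) (hα : α ≠ 0) :
    ∃ β, logPart K a α β ≠ 0 := by
  have red : ∀ (k : ℕ) (β : LogOrder), β 0 + k = α 0 → logPart K a α β =
      rfact K a * ((ExponentSystem.stirling a k : K) *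
        ((logDer K ^ k) (Finsupp.single α 1)) β) := by
    intro k β hβ
    unfold logPart
    rw [finsum_eq_single _ k]
    intro k' hk'
    by_contra h
    have := logDer_pow_apply_ne_zero (K := K) α k' β (right_ne_zero_of_mul h)
    omega
  rcases (ExponentSystem.stirling_ne_zero a : (ExponentSystem.stirling a 0 : K) ≠ 0 ∨ _) with h | h
  · refine ⟨α, ?_⟩
    rw [red 0 α (by simp)]
    simpa using ⟨ExponentSystem.fact_ne_zero a, h⟩
  · obtain ⟨i, hi⟩ : ∃ i, i ∈ α.support := by
      by_contra hne
      push Not at hne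
      apply hα
      ext i
      simpa using hne i
    refine ⟨α - initOnes i, ?_⟩
    rw [red 1 _ (by simp [initOnes_apply])]
    refine mul_ne_zero (ExponentSystem.fact_ne_zero a) (mul_ne_zero h ?_)
    rw [pow_one, logDer_single, Finsupp.finsetSum_apply, Finset.sum_eq_single i]
    · simpa using hi
    · intro j _ hj
      have : α - initOnes j ≠ α - initOnes i := by
        intro h'
        exact hj (initOnes_injective (sub_right_injective h'))
      simp [this]
    · intro h'; exact absurd hi h'

/-- For `α ≠ (0)` the coefficients of an element of `I^α` in the harmonic logarithms are unique. -/
theorem logSeries_injective [CharZero K] (α : LogOrder) (hα : α ≠ 0) :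
    Function.Injective (logSeries (E := E) (K := K) α) := by
  intro c d h
  ext a
  obtain ⟨β, hβ⟩ := exists_logPart_ne_zero (K := K) a α hα
  have := congrFun (congrFun h a) β
  exact mul_right_cancel₀ hβ this

open Classical in
/-- The coefficient family of `p ∈ I^α` (`α ≠ (0)`) in the harmonic logarithms `λ_a^α`. -/
def logCoeff (α : LogOrder) (p : LogExpr E K) : Noeth E K :=
  if h : ∃ c, logSeries α c = p then h.choose else 0

theorem logCoeff_logSeries [CharZero K] (α : LogOrder) (hα : α ≠ 0) (c : Noeth E K) :
    logCoeff α (logSeries α c) = c := by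
  have h : ∃ c', logSeries α c' = logSeries α c := ⟨c, rfl⟩
  unfold logCoeff
  rw [dif_pos h]
  exact logSeries_injective α hα h.choose_spec

end Harmonic

/-! ## Artinian operators -/

section Artinian

variable {E K : Type*} [CommRing E] [LinearOrder E] [IsStrictOrderedRing E] [Field K]

/-- A series has only finitely many exponents below any bound. -/
def LeftFinite (f : HahnSeries E K) : Prop := ∀ b, {a | a ≤ b ∧ f.coeff a ≠ 0}.Finite

theorem leftFinite_single (a : E) (r : K) : LeftFinite (HahnSeries.single a r) := by
  intro b
  refine (Set.finite_singleton a).subset ?_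
  rintro c ⟨_, hc⟩
  by_contra h
  exact hc (HahnSeries.coeff_single_of_ne h)

theorem LeftFinite.add {f g : HahnSeries E K} (hf : LeftFinite f) (hg : LeftFinite g) :
    LeftFinite (f + g) := by
  intro b
  refine ((hf b).union (hg b)).subset ?_
  rintro a ⟨ha, h⟩
  by_cases h0 : f.coeff a = 0
  · right; refine ⟨ha, ?_⟩; intro h1; apply h; simp [h0, h1]
  · left; exact ⟨ha, h0⟩

theorem LeftFinite.neg {f : HahnSeries E K} (hf : LeftFinite f) : LeftFinite (-f) := by
  intro b
  refine (hf b).subset ?_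
  rintro a ⟨ha, h⟩
  exact ⟨ha, by simpa using h⟩

theorem LeftFinite.mul {f g : HahnSeries E K} (hf : LeftFinite f) (hg : LeftFinite g) :
    LeftFinite (f * g) := by
  intro b
  refine (((hf (b - g.order)).prod (hg (b - f.order))).image (fun x => x.1 + x.2)).subset ?_
  rintro a ⟨ha, h⟩
  obtain ⟨i, hi, j, hj, rfl⟩ := HahnSeries.support_mul_subset (show a ∈ (f * g).support from h)
  have h1 : f.order ≤ i := HahnSeries.order_le_of_coeff_ne_zero hi
  have h2 : g.order ≤ j := HahnSeries.order_le_of_coeff_ne_zero hj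
  refine ⟨(i, j), ⟨⟨?_, hi⟩, ⟨?_, hj⟩⟩, rfl⟩ <;> linarith

theorem LeftFinite.pow {f : HahnSeries E K} (hf : LeftFinite f) (n : ℕ) : LeftFinite (f ^ n) := by
  induction n with
  | zero => rw [pow_zero]; exact leftFinite_single 0 1
  | succ n ih => rw [pow_succ]; exact ih.mul hf

theorem leftFinite_hsum_smul_powers [Archimedean E] {w : HahnSeries E K} (hw : LeftFinite w)
    (F : PowerSeries K) : LeftFinite (PowerSeries.heval w F) := by
  by_cases h0 : 0 < w.orderTop
  swap
  · rw [PowerSeries.heval_apply,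
      HahnSeries.SummableFamily.powerSeriesFamily_of_not_orderTop_pos h0,
      HahnSeries.SummableFamily.powerSeriesFamily_hsum_zero]
    intro b
    refine (Set.finite_singleton (0 : E)).subset ?_
    rintro c ⟨_, hc⟩
    by_contra h
    exact hc (by simp [HahnSeries.coeff_one, show c ≠ 0 from h])
  · by_cases hw0 : w = 0
    · subst hw0
      rw [PowerSeries.heval_apply, HahnSeries.SummableFamily.powerSeriesFamily_hsum_zero]
      intro b
      refine (Set.finite_singleton (0 : E)).subset ?_
      rintro c ⟨_, hc⟩
      by_contra h
      exact hc (by simp [HahnSeries.coeff_one, show c ≠ 0 from h])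
    have hpos : 0 < w.order := (HahnSeries.zero_lt_orderTop_iff hw0).1 h0
    intro b
    obtain ⟨N, hN⟩ := Archimedean.arch b hpos
    refine ((Finset.range (N + 1)).finite_toSet.biUnion fun n _ => hw.pow n b).subset ?_
    rintro a ⟨ha, h⟩
    rw [PowerSeries.coeff_heval] at h
    obtain ⟨n, hn⟩ : ∃ n, (HahnSeries.SummableFamily.powerSeriesFamily w F n).coeff a ≠ 0 := by
      by_contra hne
      push Not at hne
      apply h
      exact finsum_eq_zero_of_forall_eq_zero hne
    rw [HahnSeries.SummableFamily.powerSeriesFamily_of_orderTop_pos h0] at hn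
    have hn' : (w ^ n).coeff a ≠ 0 := by
      intro h'; apply hn; simp [h']
    have ho : n • w.order ≤ a := by
      rw [← HahnSeries.order_pow]
      exact HahnSeries.order_le_of_coeff_ne_zero hn'
    refine Set.mem_biUnion (x := n) ?_ ⟨ha, hn'⟩
    simp only [Finset.coe_range, Set.mem_Iio]
    by_contra hlt
    have h1 : (N + 1) • w.order ≤ n • w.order := nsmul_le_nsmul_left hpos.le (by omega)
    rw [succ_nsmul] at h1
    linarith

theorem LeftFinite.inv [Archimedean E] {f : HahnSeries E K} (hf : LeftFinite f) :
    LeftFinite f⁻¹ := by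
  have e : ∀ w : HahnSeries E K, (HahnSeries.SummableFamily.powers w).hsum =
      PowerSeries.heval w (PowerSeries.mk fun _ => (1 : K)) := by
    intro w
    rw [PowerSeries.heval_apply]
    congr 1
    ext n a
    simp
  rw [HahnSeries.inv_def, e]
  refine (leftFinite_single _ _).mul (leftFinite_hsum_smul_powers ?_ _)
  rw [sub_eq_add_neg]
  exact (leftFinite_single 0 1).add ((leftFinite_single _ _).mul hf).neg

variable (E K) in
/-- The algebra `Λ⁺` of Artinian operators `f(D) = ∑_b f_b D^b`: for every `b` only finitely many
`a ≤ b` have a nonzero coefficient. The operator `D` is `single 1 1`. -/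
def Artin [Archimedean E] : Subfield (HahnSeries E K) where
  carrier := {f | LeftFinite f}
  mul_mem' := fun hf hg => hf.mul hg
  one_mem' := leftFinite_single 0 1
  add_mem' := fun hf hg => hf.add hg
  zero_mem' := by intro b; simp
  neg_mem' := fun hf => hf.neg
  inv_mem' := fun _ hf => LeftFinite.inv hf

variable [Archimedean E]

instance : Module K (Artin E K) where
  smul r f := ⟨r • (f : HahnSeries E K), by
    intro b
    refine (f.2 b).subset ?_
    rintro a ⟨ha, h⟩
    refine ⟨ha, ?_⟩
    intro h'; apply h; simp [h']⟩
  one_smul f := Subtype.ext (one_smul K (f : HahnSeries E K))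
  mul_smul r s f := Subtype.ext (mul_smul r s (f : HahnSeries E K))
  smul_zero r := Subtype.ext (smul_zero r)
  smul_add r f g := Subtype.ext (smul_add r (f : HahnSeries E K) g)
  add_smul r s f := Subtype.ext (add_smul r s (f : HahnSeries E K))
  zero_smul f := Subtype.ext (zero_smul K (f : HahnSeries E K))

/-- A delta operator: an Artinian operator of degree one. -/
def IsDelta (f : Artin E K) : Prop :=
  (f : HahnSeries E K).coeff 1 ≠ 0 ∧ ∀ b < 1, (f : HahnSeries E K).coeff b = 0

variable [ExponentSystem E K]

/-- The action of an Artinian operator on coefficient families, given by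
`D^b λ_a^α = (⌊a⌉! / ⌊a - b⌉!) λ_(a-b)^α`, linearity and continuity. -/
def opCoeff (f : Artin E K) (c : Noeth E K) : Noeth E K :=
  ⟨fun a => ∑ᶠ b : E, (f : HahnSeries E K).coeff b * (rfact K (a + b) / rfact K a) *
      (c : E → K) (a + b), by
    intro B
    by_cases hf0 : (f : HahnSeries E K) = 0
    · refine Set.finite_empty.subset ?_
      rintro a ⟨_, h⟩
      apply h
      simp [hf0]
    set d := (f : HahnSeries E K).order
    have hC := c.2 (B + d)
    obtain ⟨M, hM⟩ := hC.bddAbove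
    refine (((f.2 (M - B)).prod hC).image (fun x => x.2 - x.1)).subset ?_
    rintro a ⟨ha, h⟩
    obtain ⟨b, hb⟩ : ∃ b, (f : HahnSeries E K).coeff b * (rfact K (a + b) / rfact K a) *
        (c : E → K) (a + b) ≠ 0 := by
      by_contra hne
      push Not at hne
      exact h (finsum_eq_zero_of_forall_eq_zero hne)
    have hc := right_ne_zero_of_mul hb
    have hfb := left_ne_zero_of_mul (left_ne_zero_of_mul hb)
    have hd : d ≤ b := HahnSeries.order_le_of_coeff_ne_zero hfb
    have hm : a + b ∈ {x | B + d ≤ x ∧ (c : E → K) x ≠ 0} := ⟨by linarith, hc⟩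
    have hle := hM hm
    refine ⟨(b, a + b), ⟨⟨by linarith, hfb⟩, hm⟩, by simp⟩⟩

/-- `f(D) p(x)` for `p ∈ I^α`, `α ≠ (0)`. -/
def opApply (f : Artin E K) (α : LogOrder) (p : LogExpr E K) : LogExpr E K :=
  logSeries α (opCoeff f (logCoeff α p))

/-- The augmentation `⟨p(x)⟩_α`: the coefficient of `λ_0^α` in `p ∈ I^α`, `α ≠ (0)`. -/
def aug (α : LogOrder) (p : LogExpr E K) : K := (logCoeff α p : E → K) 0

/-! ## Graded sequences -/

/-- A graded sequence `p_a^α`: it is regular (its coefficients in the harmonic logarithms do not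
depend on the order `α`), `p_a^α ∈ I^α` has degree `a`, the family is locally finite in `a`
(so that the transposed expansions are Artinian), and it depends continuously on `a`:
the series `p_a^α / ⌊a⌉! = ∑_b (d_(a,b) ⌊b⌉! / ⌊a⌉!) λ_b^α / ⌊b⌉!` depends continuously on `a`, where
exponents vary continuously, i.e. weakly against continuous functions of the exponent with support
bounded below. (Note `λ_b^α / ⌊b⌉! = D^(-b) λ_0^α`. In the discrete case the last two conditions are
automatic.) -/
def IsGraded (p : E → LogOrder → LogExpr E K) : Prop :=
  ∃ d : E → Noeth E K,
    (∀ a α, p a α = logSeries α (d a)) ∧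
    (∀ a, (d a : E → K) a ≠ 0 ∧ ∀ b > a, (d a : E → K) b = 0) ∧
    (∀ b M, {a | a ≤ M ∧ (d a : E → K) b ≠ 0}.Finite) ∧
    ∀ φ : E → K, ExponentSystem.Cont φ → (∃ N, ∀ b < N, φ b = 0) →
      ExponentSystem.Cont fun a : E =>
        ∑ᶠ b : E, φ b * ((d a : E → K) b * rfact K b / rfact K a)

/-- A Roman graded sequence: a graded sequence of binomial type,
`⟨f(D) g(D) p_a^α⟩_α = ∑_b (⌊a⌉! / (⌊b⌉! ⌊a - b⌉!)) ⟨f(D) p_b^α⟩_α ⟨g(D) p_(a-b)^α⟩_α`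
for all Artinian operators and all `α ≠ (0)`. (The sum has finitely many nonzero terms.) -/
def IsRoman (p : E → LogOrder → LogExpr E K) : Prop :=
  IsGraded p ∧ ∀ α : LogOrder, α ≠ 0 → ∀ (f g : Artin E K) (a : E),
    aug α (opApply (f * g) α (p a α)) =
      ∑ᶠ b : E, rfact K a / (rfact K b * rfact K (a - b)) *
        aug α (opApply f α (p b α)) * aug α (opApply g α (p (a - b) α))

open Classical in
/-- `p` is the associated graded sequence of the delta operator with the family of powers `P`:
`⟨f(D)^b p_a^α⟩_α = ⌊a⌉! δ_(a,b)` for all `a`, `b` and `α ≠ (0)`, where `f(D)^b = P b`. -/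
def IsAssociated (P : E → Artin E K) (p : E → LogOrder → LogExpr E K) : Prop :=
  IsGraded p ∧ ∀ α : LogOrder, α ≠ 0 → ∀ a b : E,
    aug α (opApply (P b) α (p a α)) = if a = b then rfact K a else 0

/-! ## Operators on logarithmic series -/

/-- A linear operator on a space `J` of logarithmic series is continuous if it is so at `0` for the
topology of the degree in `x`, with the neighbourhoods `{p | deg p < b}` of `0`. -/
def IsContinuousOp {J : Submodule K (LogExpr E K)} (τ : J →ₗ[K] J) : Prop :=
  ∀ b : E, ∃ c : E, ∀ p : J, (∀ a ≥ c, (p : LogExpr E K) a = 0) →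
    ∀ a ≥ b, (τ p : LogExpr E K) a = 0

/-- `τ p_a^α = q_a^α` for all `a` and all orders `α` such that `I^α` is contained in `J`. -/
def MapsSeq {J : Submodule K (LogExpr E K)} (τ : J →ₗ[K] J)
    (p q : E → LogOrder → LogExpr E K) : Prop :=
  ∀ a α, LogSpace E K α ≤ J → ∀ x : J, (x : LogExpr E K) = p a α → (τ x : LogExpr E K) = q a α

/-- `τ` is a transfer operator: the continuous linear operator with `τ λ_a^α = p_a^α` for some Roman
graded sequence `p`. -/
def IsTransfer {J : Submodule K (LogExpr E K)} (τ : J →ₗ[K] J) : Prop :=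
  IsContinuousOp τ ∧ ∃ p : E → LogOrder → LogExpr E K, IsRoman p ∧ MapsSeq τ (harmonicLog K) p

/-- `T` is the adjoint of the operator `τ`: for each `α ≠ (0)` the operator `τ` maps `I^α` to itself
and `⟨[T f(D)] p(x)⟩_α = ⟨f(D) τ p(x)⟩_α` for all `p ∈ I^α` and all Artinian operators `f(D)`. -/
def IsAdjoint {J : Submodule K (LogExpr E K)} (τ : J →ₗ[K] J)
    (T : Artin E K →ₗ[K] Artin E K) : Prop :=
  ∀ α : LogOrder, α ≠ 0 → ∀ x : J, (x : LogExpr E K) ∈ LogSpace E K α →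
    (τ x : LogExpr E K) ∈ LogSpace E K α ∧
    ∀ f : Artin E K, aug α (opApply (T f) α x) = aug α (opApply f α (τ x))

end Artinian

/-- The power `f(D)^(a;n)` of a nonzero Artinian operator with real exponents, where `a` is real and
the integer `n` chooses the branch: if `f(D) = c D^d (1 + w(D))` with `c ≠ 0` and `w(D)` of positive
degree, it is `exp(a (Log c + 2πin)) D^(ad) ∑_j (a choose j) w(D)^j`. -/
def branchPow (f : Artin ℝ ℂ) (n : ℤ) (a : ℝ) : Artin ℝ ℂ :=
  ⟨HahnSeries.single (a * (f : HahnSeries ℝ ℂ).order)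
      (Complex.exp (a * (Complex.log (f : HahnSeries ℝ ℂ).leadingCoeff +
        2 * Real.pi * Complex.I * n))) *
    PowerSeries.heval
      ((f : HahnSeries ℝ ℂ) / HahnSeries.single (f : HahnSeries ℝ ℂ).order
        (f : HahnSeries ℝ ℂ).leadingCoeff - 1)
      (PowerSeries.binomialSeries ℂ (a : ℂ)), by
    refine (leftFinite_single _ _).mul (leftFinite_hsum_smul_powers ?_ _)
    rw [div_eq_mul_inv, sub_eq_add_neg]
    exact (LeftFinite.mul f.2 (leftFinite_single _ _).inv).add (leftFinite_single 0 1).neg⟩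

end

/-! For fixed α ≠ (0) the number ⟨f(D) p⟩_α is the pairing ∑_b f_b ⌊b⌉! c_b of coefficients
(`pair`), so everything becomes linear algebra of triangular matrices. A graded sequence p is a
matrix d; it defines the operator λ_a ↦ p_a on Noetherian series (`combine`) and its adjoint on Λ⁺
(`transpose`). The coefficient of D^a in the adjoint of f is ⟨f(D) p_a⟩_α / ⌊a⌉!, so the binomial
identity merely compares coefficients in a product: p is Roman exactly if the adjoint is
multiplicative (`isRoman_iff`). Adjoints compose contravariantly, and triangularity, continuity in a
and multiplicativity survive composition. This gives claim 1.

For claims 2 and 3, the powers f^b form a second triangular matrix, `powerCoeff`. Its adjoint sends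
D^b to f^b, and is multiplicative because f^(a+b) = f^a f^b. The defining property of the associated
sequence says that its matrix is inverse to `powerCoeff` (`IsAssociated.exists_inverse`), so its
adjoint sends f^b back to D^b and is multiplicative as well. An operator τ with p_a ↦ q_a is
therefore the product of the matrix of q and the `powerCoeff` of f; its adjoint is g^b ↦ D^b ↦ f^b,
and its multiplicativity makes τ a transfer operator. Testing on single λ_a shows that the adjoint
is unique (`isTransfer_and_adjoint`).

Every passage to infinite series rests on one principle: a linear map that kills the one-term series
and all series lying far enough out vanishes. The discrete and continuous cases enter only through
⌊0⌉! = 1 and `IsPowerFamily`; its analytic content is the continuity of the real powers in the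
exponent. -/

theorem exists_ne_zero_of_finsum_ne_zero {ι M : Type*} [AddCommMonoid M] {f : ι → M}
    (h : ∑ᶠ i, f i ≠ 0) : ∃ i, f i ≠ 0 := by
  by_contra! h'
  exact h (finsum_eq_zero_of_forall_eq_zero h')

/-! ### Triangular matrices acting on Noetherian series, and their adjoints with respect to the
pairing. -/

section Pairing

set_option linter.unusedSectionVars false

variable {E K : Type*} [Field K] [ExponentSystem E K]

theorem rfact_ne_zero (a : E) : rfact K a ≠ 0 := ExponentSystem.fact_ne_zero a

/-- The pairing `∑_b φ_b ⌊b⌉! c_b` of a family of operator coefficients with the coefficients of a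
logarithmic series. -/
noncomputable def pair (φ c : E → K) : K := ∑ᶠ b, φ b * (rfact K b * c b)

variable [LinearOrder E]

/-- The coefficient family of a single harmonic logarithm. -/
noncomputable def noethSingle (K : Type*) {E : Type*} [Field K] [LinearOrder E] (a : E) :
    Noeth E K :=
  ⟨Pi.single a 1, fun _ => (Set.finite_singleton a).subset fun x hx => by
    by_contra h
    exact hx.2 (Pi.single_eq_of_ne h _)⟩

theorem noethSingle_self (a : E) : (noethSingle K a : E → K) a = 1 := Pi.single_eq_same a 1

theorem noethSingle_of_ne {a b : E} (h : b ≠ a) : (noethSingle K a : E → K) b = 0 :=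
  Pi.single_eq_of_ne h _

theorem pair_noethSingle (φ : E → K) (a : E) :
    pair φ (noethSingle K a : E → K) = φ a * rfact K a := by
  unfold pair
  rw [finsum_eq_single _ a (fun b hb => by simp [noethSingle_of_ne hb]), noethSingle_self, mul_one]

/-- Support bounded below meets Noetherian support in a finite set. This makes `pair` an honest
finite sum; bounded support suffices, φ need not be Artinian, as the continuity condition requires.
-/
theorem finite_support_mul_noeth (c : Noeth E K) {φ : E → K} (hφ : ∃ N, ∀ b < N, φ b = 0) :
    {b | φ b ≠ 0 ∧ (c : E → K) b ≠ 0}.Finite := by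
  obtain ⟨N, hN⟩ := hφ
  refine (c.2 N).subset fun b hb => ⟨?_, hb.2⟩
  by_contra h
  exact hb.1 (hN b (not_le.1 h))

/-- The pairing as a linear functional of the logarithmic series. -/
noncomputable def pairLinear (φ : E → K) (hφ : ∃ N, ∀ b < N, φ b = 0) : Noeth E K →ₗ[K] K where
  toFun c := pair φ (c : E → K)
  map_add' c d := by
    have fin (c : Noeth E K) :
        (Function.support fun b => φ b * (rfact K b * (c : E → K) b)).Finite :=
      (finite_support_mul_noeth c hφ).subset fun b hb =>
        ⟨left_ne_zero_of_mul hb, right_ne_zero_of_mul (right_ne_zero_of_mul hb)⟩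
    unfold pair
    rw [← finsum_add_distrib (fin c) (fin d)]
    exact finsum_congr fun b => by simp only [Submodule.coe_add, Pi.add_apply]; ring
  map_smul' r c := by
    simp only [pair, RingHom.id_apply, smul_eq_mul, mul_finsum]
    exact finsum_congr fun b => by
      simp only [Submodule.coe_smul, Pi.smul_apply, smul_eq_mul]; ring

/-- A linear map that kills the single harmonic logarithms and all series of sufficiently small
degree vanishes. -/
theorem noeth_linearMap_eq_zero {V : Type*} [AddCommGroup V] [Module K V]
    (A : Noeth E K →ₗ[K] V) (hA : ∃ N, ∀ c : Noeth E K, (∀ b ≥ N, (c : E → K) b = 0) → A c = 0)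
    (hs : ∀ a, A (noethSingle K a) = 0) : A = 0 := by
  obtain ⟨N, hN⟩ := hA
  ext c
  -- Cut the series at N: `t` is the finite part in degrees ≥ N, and the remainder `c - t` is killed
  -- by hypothesis.
  set s := (c.2 N).toFinset
  set t : Noeth E K := ∑ b ∈ s, (c : E → K) b • noethSingle K b
  have ht : A t = 0 := by simp [t, hs]
  have hct : A (c - t) = 0 := by
    apply hN
    intro b hb
    have e : (t : E → K) b = ∑ x ∈ s, (c : E → K) x * (noethSingle K x : E → K) b := by
      simp [t, Finset.sum_apply]
    rw [Submodule.coe_sub, Pi.sub_apply, e, Finset.sum_eq_single b, noethSingle_self, mul_one,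
      sub_self]
    · intro x _ hx
      rw [noethSingle_of_ne hx.symm, mul_zero]
    · intro h
      have : (c : E → K) b = 0 := by
        by_contra h0
        exact h ((c.2 N).mem_toFinset.2 ⟨hb, h0⟩)
      rw [this, zero_mul]
  rw [map_sub, ht, sub_zero] at hct
  simpa using hct

theorem pair_eq_zero_of_disjoint {φ c : E → K} {N : E} (hφ : ∀ b < N, φ b = 0)
    (hc : ∀ b ≥ N, c b = 0) : pair φ c = 0 :=
  finsum_eq_zero_of_forall_eq_zero fun b => by
    rcases lt_or_ge b N with h | h
    · rw [hφ b h, zero_mul]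
    · rw [hc b h, mul_zero, mul_zero]

/-- The triangularity and local finiteness conditions on the coefficients of a graded sequence. -/
structure IsTriangular (d : E → Noeth E K) : Prop where
  diag : ∀ a, (d a : E → K) a ≠ 0
  upper : ∀ a, ∀ b > a, (d a : E → K) b = 0
  finite : ∀ b M, {a | a ≤ M ∧ (d a : E → K) b ≠ 0}.Finite

theorem isTriangular_noethSingle : IsTriangular (noethSingle K : E → Noeth E K) where
  diag a := by rw [noethSingle_self]; exact one_ne_zero
  upper a b h := noethSingle_of_ne h.ne'
  finite b M := (Set.finite_singleton b).subset fun a ha => by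
    by_contra h
    exact ha.2 (noethSingle_of_ne (Ne.symm h))

theorem IsTriangular.finite_support {d : E → Noeth E K} (hd : IsTriangular d) (c : Noeth E K)
    (a : E) : (Function.support fun b => (c : E → K) b * (d b : E → K) a).Finite :=
  (c.2 a).subset fun b hb => ⟨by
    by_contra h
    exact right_ne_zero_of_mul hb (hd.upper b a (not_le.1 h)), left_ne_zero_of_mul hb⟩

/-- The series `∑_b c_b p_b`, where `p_b` has the coefficients `d_b`. -/
noncomputable def combine {d : E → Noeth E K} (hd : IsTriangular d) :
    Noeth E K →ₗ[K] Noeth E K where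
  toFun c := ⟨fun a => ∑ᶠ b, (c : E → K) b * (d b : E → K) a, by
    intro B
    refine ((c.2 B).biUnion fun b _ => (d b).2 B).subset ?_
    rintro a ⟨ha, h⟩
    obtain ⟨b, hb⟩ := exists_ne_zero_of_finsum_ne_zero h
    have hba : a ≤ b := by
      by_contra h'
      exact right_ne_zero_of_mul hb (hd.upper b a (not_le.1 h'))
    exact Set.mem_biUnion (x := b) ⟨ha.trans hba, left_ne_zero_of_mul hb⟩
      ⟨ha, right_ne_zero_of_mul hb⟩⟩
  map_add' c c' := by
    ext a
    simp only [Submodule.coe_add, Pi.add_apply, add_mul]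
    exact finsum_add_distrib (hd.finite_support c a) (hd.finite_support c' a)
  map_smul' r c := by
    ext a
    simp [mul_finsum, mul_assoc]

theorem combine_apply {d : E → Noeth E K} (hd : IsTriangular d) (c : Noeth E K) (a : E) :
    (combine hd c : E → K) a = ∑ᶠ b, (c : E → K) b * (d b : E → K) a := rfl

theorem combine_noethSingle {d : E → Noeth E K} (hd : IsTriangular d) (a : E) :
    combine hd (noethSingle K a) = d a := by
  ext x
  rw [combine_apply, finsum_eq_single _ a (fun b hb => by rw [noethSingle_of_ne hb, zero_mul]),
    noethSingle_self, one_mul]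

theorem combine_eq_self (c : Noeth E K) :
    combine isTriangular_noethSingle c = c := by
  ext b
  rw [combine_apply, finsum_eq_single _ b fun x hx => by
    rw [noethSingle_of_ne hx.symm, mul_zero], noethSingle_self, mul_one]

theorem combine_eq_zero_above {d : E → Noeth E K} (hd : IsTriangular d) {c : Noeth E K} {N : E}
    (hc : ∀ b ≥ N, (c : E → K) b = 0) : ∀ a ≥ N, (combine hd c : E → K) a = 0 := by
  intro a ha
  rw [combine_apply]
  refine finsum_eq_zero_of_forall_eq_zero fun b => ?_
  rcases lt_or_ge b N with h | h
  · rw [hd.upper b a (h.trans_le ha), mul_zero]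
  · rw [hc b h, zero_mul]

theorem combine_diag {d : E → Noeth E K} (hd : IsTriangular d) {c : Noeth E K} {a : E}
    (hc : ∀ b > a, (c : E → K) b = 0) :
    (combine hd c : E → K) a = (c : E → K) a * (d a : E → K) a := by
  rw [combine_apply]
  refine finsum_eq_single _ a fun b hb => ?_
  rcases lt_or_gt_of_ne hb with h | h
  · rw [hd.upper b a h, mul_zero]
  · rw [hc b h, zero_mul]

/-- Leading terms: a nonzero Noetherian series has a highest exponent m, and there the image has
coefficient c_m d_mm ≠ 0. -/
theorem combine_injective {d : E → Noeth E K} (hd : IsTriangular d) :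
    Function.Injective (combine hd) := by
  rw [← LinearMap.ker_eq_bot, LinearMap.ker_eq_bot']
  intro c hc
  by_contra h0
  obtain ⟨x, hx⟩ : ∃ x, (c : E → K) x ≠ 0 := by
    by_contra! h
    exact h0 (Subtype.ext (funext h))
  obtain ⟨m, ⟨hxm, hm⟩, hmax⟩ := (c.2 x).exists_maximal ⟨x, le_rfl, hx⟩
  have h1 : (combine hd c : E → K) m = (c : E → K) m * (d m : E → K) m := by
    refine combine_diag hd fun b hb => ?_
    by_contra h
    exact absurd (hmax ⟨hxm.trans hb.le, h⟩ hb.le) (not_le.2 hb)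
  rw [hc] at h1
  exact mul_ne_zero hm (hd.diag m) h1.symm

theorem IsTriangular.comp {d e : E → Noeth E K} (hd : IsTriangular d) (he : IsTriangular e) :
    IsTriangular fun a => combine hd (e a) where
  diag a := by
    rw [combine_diag hd (he.upper a)]
    exact mul_ne_zero (he.diag a) (hd.diag a)
  upper a b h := by
    rw [combine_apply]
    refine finsum_eq_zero_of_forall_eq_zero fun x => ?_
    rcases lt_or_ge a x with h' | h'
    · rw [he.upper a x h', zero_mul]
    · rw [hd.upper x b (h'.trans_lt h), mul_zero]
  finite b M := by
    -- The entry at b is ∑_x e_(a,x) d_(x,b), where only x ≤ a ≤ M occur. So d leaves finitely many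
    -- x, and e leaves finitely many a for each x.
    refine ((hd.finite b M).biUnion fun x _ => he.finite x M).subset ?_
    rintro a ⟨ha, h⟩
    obtain ⟨x, hx⟩ := exists_ne_zero_of_finsum_ne_zero h
    have hxa : x ≤ a := by
      by_contra h'
      exact left_ne_zero_of_mul hx (he.upper a x (not_le.1 h'))
    exact Set.mem_biUnion (x := x) ⟨hxa.trans ha, right_ne_zero_of_mul hx⟩
      ⟨ha, left_ne_zero_of_mul hx⟩

/-- The coefficients of the adjoint of `λ_a ↦ p_a`, where `p_a` has the coefficients `d_a`. -/
noncomputable def transposeFun (d : E → Noeth E K) (φ : E → K) (a : E) : K :=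
  pair φ (d a : E → K) / rfact K a

theorem transposeFun_eq_zero_below {d : E → Noeth E K} (hd : IsTriangular d) {φ : E → K} {N : E}
    (hφ : ∀ b < N, φ b = 0) : ∀ a < N, transposeFun d φ a = 0 := by
  intro a ha
  rw [transposeFun, pair_eq_zero_of_disjoint hφ fun b hb => hd.upper a b (ha.trans_le hb),
    zero_div]

/-- Both sides are linear in c and vanish for c of degree below the support of φ, so it suffices to
take c = λ_a, where the equation is the definition of `transposeFun`. -/
theorem pair_transposeFun {d : E → Noeth E K} (hd : IsTriangular d) {φ : E → K}
    (hφ : ∃ N, ∀ b < N, φ b = 0) (c : Noeth E K) :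
    pair (transposeFun d φ) (c : E → K) = pair φ (combine hd c : E → K) := by
  have hφ' : ∃ N, ∀ b < N, transposeFun d φ b = 0 :=
    hφ.imp fun _ h => transposeFun_eq_zero_below hd h
  have key : pairLinear _ hφ' - pairLinear φ hφ ∘ₗ combine hd = 0 := by
    apply noeth_linearMap_eq_zero
    · obtain ⟨N, hN⟩ := hφ
      refine ⟨N, fun c hc => ?_⟩
      have h1 : pair (transposeFun d φ) (c : E → K) = 0 :=
        pair_eq_zero_of_disjoint (transposeFun_eq_zero_below hd hN) hc
      have h2 : pair φ (combine hd c : E → K) = 0 :=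
        pair_eq_zero_of_disjoint hN (combine_eq_zero_above hd hc)
      change pair (transposeFun d φ) (c : E → K) - pair φ (combine hd c : E → K) = 0
      rw [h1, h2, sub_zero]
    · intro a
      change pair (transposeFun d φ) (noethSingle K a : E → K) -
        pair φ (combine hd (noethSingle K a) : E → K) = 0
      rw [pair_noethSingle, combine_noethSingle, transposeFun, div_mul_cancel₀ _ (rfact_ne_zero a),
        sub_self]
  exact sub_eq_zero.1 (LinearMap.congr_fun key c)

theorem transposeFun_comp {d e : E → Noeth E K} (hd : IsTriangular d) {φ : E → K}
    (hφ : ∃ N, ∀ b < N, φ b = 0) :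
    transposeFun (fun a => combine hd (e a)) φ = transposeFun e (transposeFun d φ) := by
  funext a
  rw [transposeFun, transposeFun, pair_transposeFun hd hφ]

theorem transposeFun_noethSingle (φ : E → K) : transposeFun (noethSingle K) φ = φ := by
  funext a
  rw [transposeFun, pair_noethSingle, mul_div_cancel_right₀ _ (rfact_ne_zero a)]

/-- The continuity condition on the coefficients of a graded sequence. -/
def IsContFamily (d : E → Noeth E K) : Prop :=
  ∀ φ : E → K, ExponentSystem.Cont φ → (∃ N, ∀ b < N, φ b = 0) →
    ExponentSystem.Cont (transposeFun d φ)

/-- Continuity is a condition on the adjoint, so it composes contravariantly; the intermediate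
function still has support bounded below because d is triangular. -/
theorem IsContFamily.comp {d e : E → Noeth E K} (hd : IsTriangular d) (hdc : IsContFamily d)
    (hec : IsContFamily e) : IsContFamily fun a => combine hd (e a) := by
  intro φ hφ hN
  rw [transposeFun_comp hd hN]
  exact hec _ (hdc φ hφ hN) (hN.imp fun _ h => transposeFun_eq_zero_below hd h)

end Pairing

/-! ### Adjoints on Artinian operators, and Roman sequences as multiplicative adjoints. -/

section Adjoint

set_option linter.unusedSectionVars false

variable {E K : Type*} [CommRing E] [LinearOrder E] [IsStrictOrderedRing E] [Field K]
  [Archimedean E]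

/-- The coefficients of an Artinian operator. -/
def artinCoeff (f : Artin E K) : E → K := (f : HahnSeries E K).coeff

theorem artinCoeff_injective : Function.Injective (artinCoeff : Artin E K → E → K) :=
  fun _ _ h => Subtype.ext (HahnSeries.ext h)

theorem artinCoeff_add (f g : Artin E K) (a : E) :
    artinCoeff (f + g) a = artinCoeff f a + artinCoeff g a := rfl

theorem artinCoeff_smul (r : K) (f : Artin E K) (a : E) :
    artinCoeff (r • f) a = r * artinCoeff f a := rfl

theorem artinCoeff_bounded (f : Artin E K) : ∃ N, ∀ b < N, artinCoeff f b = 0 :=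
  ⟨(f : HahnSeries E K).order, fun _ hb => HahnSeries.coeff_eq_zero_of_lt_order hb⟩

/-- The Artinian operator with given coefficients. -/
def artinOf (φ : E → K) (h : ∀ b, {a | a ≤ b ∧ φ a ≠ 0}.Finite) : Artin E K :=
  ⟨⟨φ, by
    -- An infinite strictly descending sequence in the support would lie below its first term,
    -- against left finiteness.
    rw [Set.isPWO_iff_isWF, Set.isWF_iff_no_descending_seq]
    intro s hs hmem
    refine (Set.infinite_range_of_injective hs.injective) ((h (s 0)).subset ?_)
    rintro _ ⟨n, rfl⟩
    exact ⟨hs.antitone (Nat.zero_le n), hmem n⟩⟩, h⟩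

/-- The operator `D^b`. -/
noncomputable def dPow (K : Type*) {E : Type*} [CommRing E] [LinearOrder E]
    [IsStrictOrderedRing E] [Field K] [Archimedean E] (b : E) : Artin E K :=
  ⟨HahnSeries.single b 1, leftFinite_single b 1⟩

theorem artinCoeff_dPow_self (b : E) : artinCoeff (dPow K b) b = 1 :=
  HahnSeries.coeff_single_same b 1

theorem artinCoeff_dPow_of_ne {a b : E} (h : a ≠ b) : artinCoeff (dPow K b) a = 0 :=
  HahnSeries.coeff_single_of_ne h

theorem dPow_mul (a b : E) : dPow K a * dPow K b = dPow K (a + b) :=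
  Subtype.ext (by simp [dPow])

/-- The mirror image of `noeth_linearMap_eq_zero`: the finitely many terms up to N split off, and
what is left has high degree. -/
theorem artin_linearMap_eq_zero {V : Type*} [AddCommGroup V] [Module K V]
    (A : Artin E K →ₗ[K] V)
    (hA : ∃ N, ∀ f : Artin E K, (∀ b < N, artinCoeff f b = 0) → A f = 0)
    (hs : ∀ b, A (dPow K b) = 0) : A = 0 := by
  obtain ⟨N, hN⟩ := hA
  refine LinearMap.ext fun f => ?_
  set s := (f.2 N).toFinset
  set t : Artin E K := ∑ b ∈ s, artinCoeff f b • dPow K b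
  have ht : A t = 0 := by simp [t, hs]
  let ev (b : E) : Artin E K →ₗ[K] K :=
    { toFun := fun f => artinCoeff f b
      map_add' := fun f g => rfl
      map_smul' := fun r f => rfl }
  have hft : A (f - t) = 0 := by
    apply hN
    intro b hb
    change ev b (f - t) = 0
    rw [map_sub, map_sum]
    simp only [map_smul]
    change artinCoeff f b - ∑ x ∈ s, artinCoeff f x * artinCoeff (dPow K x) b = 0
    rw [Finset.sum_eq_single b, artinCoeff_dPow_self, mul_one, sub_self]
    · intro x _ hx
      rw [artinCoeff_dPow_of_ne hx.symm, mul_zero]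
    · intro h
      have : artinCoeff f b = 0 := by
        by_contra h0
        exact h ((f.2 N).mem_toFinset.2 ⟨hb.le, h0⟩)
      rw [this, zero_mul]
  rw [map_sub, ht, sub_zero] at hft
  simpa using hft

theorem artinCoeff_mul_eq_zero {f g : Artin E K} {M N : E} (hf : ∀ b < M, artinCoeff f b = 0)
    (hg : ∀ b < N, artinCoeff g b = 0) : ∀ b < M + N, artinCoeff (f * g) b = 0 := by
  intro b hb
  by_contra h
  obtain ⟨i, hi, j, hj, rfl⟩ := HahnSeries.support_mul_subset
    (show b ∈ ((f : HahnSeries E K) * (g : HahnSeries E K)).support from h)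
  have h1 : M ≤ i := not_lt.1 fun h => hi (hf i h)
  have h2 : N ≤ j := not_lt.1 fun h => hj (hg j h)
  exact absurd hb (not_lt.2 (add_le_add h1 h2))

theorem artinCoeff_mul (f g : Artin E K) (a : E) :
    artinCoeff (f * g) a = ∑ᶠ b, artinCoeff f b * artinCoeff g (a - b) := by
  obtain ⟨F, hF⟩ := f
  obtain ⟨G, hG⟩ := g
  change (F * G).coeff a = ∑ᶠ b, F.coeff b * G.coeff (a - b)
  set s := Finset.antidiagonal F.isPWO_support G.isPWO_support a
  have hinj : Set.InjOn Prod.fst (s : Set (E × E)) := by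
    rintro ⟨x, y⟩ h ⟨x', y'⟩ h' (rfl : x = x')
    have h1 : x + y = a := (Finset.mem_antidiagonal.1 h).2.2
    have h2 : x + y' = a := (Finset.mem_antidiagonal.1 h').2.2
    exact Prod.ext rfl (add_left_cancel (h1.trans h2.symm))
  rw [HahnSeries.coeff_mul, finsum_eq_sum_of_support_subset (s := s.image Prod.fst),
    Finset.sum_image hinj]
  · refine Finset.sum_congr rfl fun x hx => ?_
    rw [← (Finset.mem_antidiagonal.1 hx).2.2, add_sub_cancel_left]
  · intro b hb
    rw [Finset.mem_coe, Finset.mem_image]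
    exact ⟨(b, a - b), Finset.mem_antidiagonal.2 ⟨left_ne_zero_of_mul hb,
      right_ne_zero_of_mul hb, add_sub_cancel b a⟩, rfl⟩

theorem artin_smul_mul (r : K) (f g : Artin E K) : (r • f) * g = r • (f * g) :=
  artinCoeff_injective <| funext fun a => by
    rw [artinCoeff_smul, artinCoeff_mul, artinCoeff_mul, mul_finsum]
    exact finsum_congr fun b => by rw [artinCoeff_smul, mul_assoc]

/-- A linear map of Artinian operators that does not lower degrees and is multiplicative on
the powers of `D` is multiplicative. -/
theorem artin_map_mul {T : Artin E K →ₗ[K] Artin E K}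
    (hT : ∀ f N, (∀ b < N, artinCoeff f b = 0) → ∀ b < N, artinCoeff (T f) b = 0)
    (hmul : ∀ a b, T (dPow K a * dPow K b) = T (dPow K a) * T (dPow K b)) (f g : Artin E K) :
    T (f * g) = T f * T g := by
  -- Extension from powers of D to all operators in one factor. It is used for f with g fixed and,
  -- by commutativity, for g with f a power of D.
  have ext_left (g : Artin E K) (h : ∀ b, T (dPow K b * g) = T (dPow K b) * T g)
      (f : Artin E K) : T (f * g) = T f * T g := by
    apply artinCoeff_injective
    funext a
    let A : Artin E K →ₗ[K] K :=
      { toFun := fun f => artinCoeff (T (f * g)) a - artinCoeff (T f * T g) a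
        map_add' := fun f f' => by
          rw [add_mul, map_add, map_add, add_mul, artinCoeff_add, artinCoeff_add]; ring
        map_smul' := fun r f => by
          rw [artin_smul_mul, map_smul, map_smul, artin_smul_mul, artinCoeff_smul,
            artinCoeff_smul, RingHom.id_apply, smul_eq_mul]; ring }
    have hA : A = 0 := by
      apply artin_linearMap_eq_zero
      · obtain ⟨M, hM⟩ := artinCoeff_bounded g
        -- If f vanishes below a - M + 1 and g below M, both products vanish below a + 1, in
        -- particular at a.
        refine ⟨a - M + 1, fun f hf => ?_⟩
        have ha : a < a - M + 1 + M := by linarith [zero_lt_one' E]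
        change artinCoeff (T (f * g)) a - artinCoeff (T f * T g) a = 0
        rw [hT _ _ (artinCoeff_mul_eq_zero hf hM) a ha,
          artinCoeff_mul_eq_zero (hT f _ hf) (hT g _ hM) a ha, sub_zero]
      · intro b
        exact sub_eq_zero.2 (by rw [h])
    exact sub_eq_zero.1 (LinearMap.congr_fun hA f)
  refine ext_left g (fun b => ?_) f
  rw [mul_comm, mul_comm (T _)]
  exact ext_left _ (fun a => hmul a b) g

variable [ExponentSystem E K]

/-- Here the local finiteness in a of a graded sequence is needed: it keeps the adjoint inside Λ⁺.
-/
theorem leftFinite_transposeFun {d : E → Noeth E K} (hd : IsTriangular d) (f : Artin E K) (b : E) :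
    {a | a ≤ b ∧ transposeFun d (artinCoeff f) a ≠ 0}.Finite := by
  refine ((f.2 b).biUnion fun x _ => hd.finite x b).subset ?_
  rintro a ⟨ha, h⟩
  obtain ⟨x, hx⟩ := exists_ne_zero_of_finsum_ne_zero (div_ne_zero_iff.1 h).1
  have hdx := right_ne_zero_of_mul (right_ne_zero_of_mul hx)
  have hxa : x ≤ a := by
    by_contra h'
    exact hdx (hd.upper a x (not_le.1 h'))
  exact Set.mem_biUnion (x := x) ⟨hxa.trans ha, left_ne_zero_of_mul hx⟩ ⟨ha, hdx⟩

theorem pair_add_left {φ ψ : E → K} (hφ : ∃ N, ∀ b < N, φ b = 0) (hψ : ∃ N, ∀ b < N, ψ b = 0)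
    (c : Noeth E K) : pair (φ + ψ) (c : E → K) = pair φ (c : E → K) + pair ψ (c : E → K) := by
  have fin {φ : E → K} (hφ : ∃ N, ∀ b < N, φ b = 0) :
      (Function.support fun b => φ b * (rfact K b * (c : E → K) b)).Finite :=
    (finite_support_mul_noeth c hφ).subset fun b hb =>
      ⟨left_ne_zero_of_mul hb, right_ne_zero_of_mul (right_ne_zero_of_mul hb)⟩
  unfold pair
  rw [← finsum_add_distrib (fin hφ) (fin hψ)]
  exact finsum_congr fun b => by rw [Pi.add_apply, add_mul]

/-- The adjoint of the operator `λ_a ↦ p_a`, where `p_a` has the coefficients `d_a`. -/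
noncomputable def transpose {d : E → Noeth E K} (hd : IsTriangular d) :
    Artin E K →ₗ[K] Artin E K where
  toFun f := artinOf (transposeFun d (artinCoeff f)) (leftFinite_transposeFun hd f)
  map_add' f g := artinCoeff_injective <| by
    funext a
    change pair (artinCoeff f + artinCoeff g) (d a : E → K) / rfact K a =
      pair (artinCoeff f) (d a : E → K) / rfact K a + pair (artinCoeff g) (d a : E → K) / rfact K a
    rw [pair_add_left (artinCoeff_bounded f) (artinCoeff_bounded g), add_div]
  map_smul' r f := artinCoeff_injective <| by
    funext a
    change pair (fun b => r * artinCoeff f b) (d a : E → K) / rfact K a =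
      r * (pair (artinCoeff f) (d a : E → K) / rfact K a)
    rw [← mul_div_assoc]
    congr 1
    simp only [pair, mul_finsum, mul_assoc]

theorem artinCoeff_transpose {d : E → Noeth E K} (hd : IsTriangular d) (f : Artin E K) :
    artinCoeff (transpose hd f) = transposeFun d (artinCoeff f) := rfl

theorem pair_transpose {d : E → Noeth E K} (hd : IsTriangular d) (f : Artin E K) (c : Noeth E K) :
    pair (artinCoeff (transpose hd f)) (c : E → K) =
      pair (artinCoeff f) (combine hd c : E → K) :=
  pair_transposeFun hd (artinCoeff_bounded f) c

theorem transpose_comp {d e : E → Noeth E K} (hd : IsTriangular d) (he : IsTriangular e)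
    (f : Artin E K) : transpose (hd.comp he) f = transpose he (transpose hd f) :=
  artinCoeff_injective (transposeFun_comp hd (artinCoeff_bounded f))

theorem transpose_eq_self {d : E → Noeth E K} (hd : IsTriangular d) (h : d = noethSingle K)
    (f : Artin E K) : transpose hd f = f := by
  subst h
  exact artinCoeff_injective (transposeFun_noethSingle _)

/-- The constant coefficient of f(D) p collects the terms with factor ⌊b⌉! / ⌊0⌉!, so ⌊0⌉! = 1 turns
it into the pairing. The right side no longer involves α. -/
theorem aug_opApply [CharZero K] (h0 : rfact K (0 : E) = 1) {α : LogOrder} (hα : α ≠ 0)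
    (f : Artin E K) (c : Noeth E K) :
    aug α (opApply f α (logSeries α c)) = pair (artinCoeff f) (c : E → K) := by
  rw [aug, opApply, logCoeff_logSeries α hα, logCoeff_logSeries α hα]
  refine finsum_congr fun b => ?_
  rw [zero_add, h0, div_one, mul_assoc]
  rfl

theorem harmonicLog_eq_logSeries (a : E) (α : LogOrder) :
    harmonicLog K a α = logSeries α (noethSingle K a) := by
  funext x β
  simp only [harmonicLog]
  change _ = (noethSingle K a : E → K) x * logPart K x α β
  split_ifs with h
  · rw [h, noethSingle_self, one_mul]
  · rw [noethSingle_of_ne h, zero_mul]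

theorem isGraded_iff {p : E → LogOrder → LogExpr E K} :
    IsGraded p ↔ ∃ d : E → Noeth E K, (∀ a α, p a α = logSeries α (d a)) ∧
      IsTriangular d ∧ IsContFamily d := by
  have e (d : E → Noeth E K) (φ : E → K) :
      (fun a : E => ∑ᶠ b : E, φ b * ((d a : E → K) b * rfact K b / rfact K a)) =
        transposeFun d φ := by
    funext a
    rw [transposeFun, pair, div_eq_mul_inv, finsum_mul]
    exact finsum_congr fun b => by ring
  simp only [IsGraded, e]
  exact exists_congr fun d => and_congr_right fun _ =>
    ⟨fun h => ⟨⟨fun a => (h.1 a).1, fun a => (h.1 a).2, h.2.1⟩, h.2.2⟩,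
      fun h => ⟨fun a => ⟨h.1.diag a, h.1.upper a⟩, h.1.finite, h.2⟩⟩

/-- Since coefficients do not depend on the order, one nonzero α suffices to read off every
coefficient identity. -/
theorem exists_logOrder_ne_zero : ∃ α : LogOrder, α ≠ 0 :=
  ⟨Finsupp.single 0 1, by simp⟩

/-- A sequence is Roman graded exactly if it is graded and the adjoint of `λ_a ↦ p_a` is
multiplicative. -/
theorem isRoman_iff [CharZero K] (h0 : rfact K (0 : E) = 1) {p : E → LogOrder → LogExpr E K} :
    IsRoman p ↔ ∃ (d : E → Noeth E K) (hd : IsTriangular d), (∀ a α, p a α = logSeries α (d a)) ∧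
      IsContFamily d ∧ ∀ f g, transpose hd (f * g) = transpose hd f * transpose hd g := by
  have key (d : E → Noeth E K) (hd : IsTriangular d) (hp : ∀ a α, p a α = logSeries α (d a))
      (α : LogOrder) (hα : α ≠ 0) (f g : Artin E K) (a : E) :
      (aug α (opApply (f * g) α (p a α)) =
        ∑ᶠ b : E, rfact K a / (rfact K b * rfact K (a - b)) *
          aug α (opApply f α (p b α)) * aug α (opApply g α (p (a - b) α))) ↔
      artinCoeff (transpose hd (f * g)) a = artinCoeff (transpose hd f * transpose hd g) a := by
    rw [artinCoeff_mul]
    simp only [hp, aug_opApply h0 hα]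
    -- Dividing by ⌊b⌉! and ⌊a - b⌉! turns the binomial sum into the convolution of the coefficients
    -- of the two adjoints.
    have e : ∑ᶠ b : E, rfact K a / (rfact K b * rfact K (a - b)) *
        pair (artinCoeff f) (d b : E → K) * pair (artinCoeff g) (d (a - b) : E → K) =
        rfact K a * ∑ᶠ b, artinCoeff (transpose hd f) b * artinCoeff (transpose hd g) (a - b) := by
      rw [mul_finsum]
      refine finsum_congr fun b => ?_
      have h1 := rfact_ne_zero (K := K) b
      have h2 := rfact_ne_zero (K := K) (a - b)
      simp only [artinCoeff_transpose, transposeFun]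
      field_simp
    rw [e, show artinCoeff (transpose hd (f * g)) a =
      pair (artinCoeff (f * g)) (d a : E → K) / rfact K a from rfl, div_eq_iff (rfact_ne_zero a), mul_comm (rfact K a)]
  constructor
  · rintro ⟨hg, hr⟩
    obtain ⟨d, hp, hd, hc⟩ := isGraded_iff.1 hg
    obtain ⟨α, hα⟩ := exists_logOrder_ne_zero
    exact ⟨d, hd, hp, hc, fun f g => artinCoeff_injective <| funext fun a =>
      (key d hd hp α hα f g a).1 (hr α hα f g a)⟩
  · rintro ⟨d, hd, hp, hc, hm⟩
    exact ⟨isGraded_iff.2 ⟨d, hp, hd, hc⟩, fun α hα f g a =>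
      (key d hd hp α hα f g a).2 (by rw [hm])⟩

theorem logSeries_eq_zero_above {α : LogOrder} {c : Noeth E K} {N : E}
    (hc : ∀ b ≥ N, (c : E → K) b = 0) : ∀ a ≥ N, logSeries α c a = 0 := by
  intro a ha
  funext β
  change (c : E → K) a * logPart K a α β = 0
  rw [hc a ha, zero_mul]

/-- A continuous operator with `τ p_a = q_a` maps `∑_a c_a p_a` to `∑_a c_a q_a`. -/
theorem map_logSeries_combine {J : Submodule K (LogExpr E K)} {τ : J →ₗ[K] J}
    (hτ : IsContinuousOp τ) {d e : E → Noeth E K} (hd : IsTriangular d) (he : IsTriangular e)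
    {p q : E → LogOrder → LogExpr E K} (hp : ∀ a α, p a α = logSeries α (d a))
    (hq : ∀ a α, q a α = logSeries α (e a)) (hpq : MapsSeq τ p q) {α : LogOrder}
    (hα : LogSpace E K α ≤ J) (c : Noeth E K) (x : J)
    (hx : (x : LogExpr E K) = logSeries α (combine hd c)) :
    (τ x : LogExpr E K) = logSeries α (combine he c) := by
  let ι : Noeth E K →ₗ[K] J :=
    LinearMap.codRestrict J (logSeries α) fun c => hα (LinearMap.mem_range_self _ c)
  have hx' : x = ι (combine hd c) := Subtype.ext hx
  rw [hx']
  funext a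
  -- Fix the power x^a and compare the two sides there, as linear maps of c.
  let A : Noeth E K →ₗ[K] (LogOrder → K) :=
    LinearMap.proj a ∘ₗ (J.subtype ∘ₗ τ ∘ₗ ι ∘ₗ combine hd - logSeries α ∘ₗ combine he)
  have hA (c : Noeth E K) : A c =
    (τ (ι (combine hd c)) : LogExpr E K) a - logSeries α (combine he c) a := rfl
  have h : A = 0 := by
    apply noeth_linearMap_eq_zero
    · obtain ⟨N, hN⟩ := hτ a
      -- The bound N makes the image under τ vanish at x^a by continuity; the bound a does the same
      -- for the triangular sum on the right.
      refine ⟨min N a, fun c hc => ?_⟩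
      rw [hA, logSeries_eq_zero_above (combine_eq_zero_above he hc) a (min_le_right N a),
        hN (ι (combine hd c)) (fun b hb => logSeries_eq_zero_above (combine_eq_zero_above hd hc) b
          ((min_le_left N a).trans hb)) a le_rfl, sub_zero]
    · intro b
      rw [hA, combine_noethSingle, combine_noethSingle, hpq b α hα (ι (d b)) (hp b α).symm, hq,
        sub_self]
  exact sub_eq_zero.1 ((hA c).symm.trans (LinearMap.congr_fun h c))

/-- Transfer operators map Roman graded sequences to Roman graded sequences. -/
theorem IsTransfer.exists_isRoman [CharZero K] (h0 : rfact K (0 : E) = 1)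
    {J : Submodule K (LogExpr E K)} {τ : J →ₗ[K] J} (hτ : IsTransfer τ)
    {q : E → LogOrder → LogExpr E K} (hq : IsRoman q) :
    ∃ r : E → LogOrder → LogExpr E K, IsRoman r ∧ MapsSeq τ q r := by
  obtain ⟨hcont, p, hp, hmap⟩ := hτ
  obtain ⟨d, hd, hpd, hdc, hdm⟩ := (isRoman_iff h0).1 hp
  obtain ⟨e, he, hqe, hec, hem⟩ := (isRoman_iff h0).1 hq
  refine ⟨fun a α => logSeries α (combine hd (e a)), (isRoman_iff h0).2
    ⟨_, hd.comp he, fun _ _ => rfl, hdc.comp hd hec, fun f g => ?_⟩, ?_⟩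
  · simp only [transpose_comp hd he, hdm, hem]
  · intro a α hα x hx
    refine map_logSeries_combine hcont isTriangular_noethSingle hd harmonicLog_eq_logSeries hpd
      hmap hα (e a) x ?_
    rw [hx, hqe, combine_eq_self]

end Adjoint

/-! ### Associated sequences as inverse matrices of power families, and the abstract form of claims
2 and 3. -/

section PowerFamily

set_option linter.unusedSectionVars false

variable {E K : Type*} [CommRing E] [LinearOrder E] [IsStrictOrderedRing E] [Field K]
  [Archimedean E] [ExponentSystem E K]

/-- The properties of the family `b ↦ f(D)^b` of the powers of a delta operator. -/
structure IsPowerFamily (P : E → Artin E K) : Prop where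
  add : ∀ a b, P (a + b) = P a * P b
  lowest : ∀ b, artinCoeff (P b) b ≠ 0
  below : ∀ b, ∀ c < b, artinCoeff (P b) c = 0
  finite : ∀ c B, {b | B ≤ b ∧ artinCoeff (P b) c ≠ 0}.Finite
  cont : ∀ φ : E → K, ExponentSystem.Cont φ → (∃ N, ∀ b < N, φ b = 0) →
    ExponentSystem.Cont fun c : E => ∑ᶠ b, φ b * artinCoeff (P b) c

/-- The coefficients of the harmonic logarithms in the associated sequence of a delta operator
with powers `P`. -/
noncomputable def powerCoeff {P : E → Artin E K} (hP : IsPowerFamily P) (c : E) : Noeth E K :=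
  ⟨fun b => artinCoeff (P b) c * rfact K c / rfact K b, fun B =>
    (hP.finite c B).subset fun _ hb =>
      ⟨hb.1, left_ne_zero_of_mul (div_ne_zero_iff.1 hb.2).1⟩⟩

theorem powerCoeff_apply {P : E → Artin E K} (hP : IsPowerFamily P) (b c : E) :
    (powerCoeff hP c : E → K) b = artinCoeff (P b) c * rfact K c / rfact K b := rfl

theorem isTriangular_powerCoeff {P : E → Artin E K} (hP : IsPowerFamily P) :
    IsTriangular (powerCoeff hP) where
  diag a := by
    rw [powerCoeff_apply]
    exact div_ne_zero (mul_ne_zero (hP.lowest a) (rfact_ne_zero a)) (rfact_ne_zero a)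
  upper a b h := by rw [powerCoeff_apply, hP.below b a h, zero_mul, zero_div]
  finite b M := ((P b).2 M).subset fun _ ha =>
    ⟨ha.1, left_ne_zero_of_mul (div_ne_zero_iff.1 ha.2).1⟩

theorem transposeFun_powerCoeff {P : E → Artin E K} (hP : IsPowerFamily P) (φ : E → K) :
    transposeFun (powerCoeff hP) φ = fun c => ∑ᶠ b, φ b * artinCoeff (P b) c := by
  funext c
  rw [transposeFun, pair, div_eq_mul_inv, finsum_mul]
  refine finsum_congr fun b => ?_
  have h1 := rfact_ne_zero (K := K) b
  have h2 := rfact_ne_zero (K := K) c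
  rw [powerCoeff_apply]
  field_simp

theorem isContFamily_powerCoeff {P : E → Artin E K} (hP : IsPowerFamily P) :
    IsContFamily (powerCoeff hP) := by
  intro φ hφ hN
  rw [transposeFun_powerCoeff]
  exact hP.cont φ hφ hN

theorem transpose_powerCoeff_dPow {P : E → Artin E K} (hP : IsPowerFamily P) (b : E) :
    transpose (isTriangular_powerCoeff hP) (dPow K b) = P b := by
  apply artinCoeff_injective
  rw [artinCoeff_transpose, transposeFun_powerCoeff]
  funext c
  rw [finsum_eq_single _ b fun x hx => by rw [artinCoeff_dPow_of_ne hx, zero_mul],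
    artinCoeff_dPow_self, one_mul]

/-- On powers of D this is the law P (a + b) = P a * P b; triangularity lets `artin_map_mul` extend
it. -/
theorem transpose_powerCoeff_mul {P : E → Artin E K} (hP : IsPowerFamily P) (f g : Artin E K) :
    transpose (isTriangular_powerCoeff hP) (f * g) =
      transpose (isTriangular_powerCoeff hP) f * transpose (isTriangular_powerCoeff hP) g := by
  refine artin_map_mul (T := transpose (isTriangular_powerCoeff hP))
    (fun f N hf => transposeFun_eq_zero_below (isTriangular_powerCoeff hP) hf)
    (fun a b => ?_) f g
  rw [dPow_mul, transpose_powerCoeff_dPow, transpose_powerCoeff_dPow, transpose_powerCoeff_dPow,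
    hP.add]

/-- This translates association into matrices: ⟨f^b p_a⟩_α = ⌊a⌉! δ_(a,b) says that this operator
sends the coefficients of p_a to those of λ_a. -/
theorem combine_powerCoeff {P : E → Artin E K} (hP : IsPowerFamily P) (c : Noeth E K) (b : E) :
    (combine (isTriangular_powerCoeff hP) c : E → K) b =
      pair (artinCoeff (P b)) (c : E → K) / rfact K b := by
  rw [combine_apply, pair, div_eq_mul_inv, finsum_mul]
  exact finsum_congr fun a => by rw [powerCoeff_apply]; ring

/-- The coefficients of an associated sequence: they are inverse to `powerCoeff`. -/
theorem IsAssociated.exists_inverse [CharZero K] (h0 : rfact K (0 : E) = 1)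
    {P : E → Artin E K} (hP : IsPowerFamily P) {p : E → LogOrder → LogExpr E K}
    (hp : IsAssociated P p) :
    ∃ (d : E → Noeth E K) (hd : IsTriangular d), (∀ a α, p a α = logSeries α (d a)) ∧
      IsContFamily d ∧
      (∀ a, combine (isTriangular_powerCoeff hP) (d a) = noethSingle K a) ∧
      (∀ a, combine hd (powerCoeff hP a) = noethSingle K a) ∧
      ∀ b, transpose hd (P b) = dPow K b := by
  obtain ⟨hg, ha⟩ := hp
  obtain ⟨d, hpd, hd, hc⟩ := isGraded_iff.1 hg
  obtain ⟨α, hα⟩ := exists_logOrder_ne_zero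
  have hpair_self (a : E) : pair (artinCoeff (P a)) (d a : E → K) = rfact K a := by
    rw [← aug_opApply h0 hα, ← hpd, ha α hα, if_pos rfl]
  have hpair_ne {a b : E} (h : a ≠ b) : pair (artinCoeff (P b)) (d a : E → K) = 0 := by
    rw [← aug_opApply h0 hα, ← hpd, ha α hα, if_neg h]
  have h1 (a : E) : combine (isTriangular_powerCoeff hP) (d a) = noethSingle K a := by
    ext b
    rw [combine_powerCoeff]
    rcases eq_or_ne b a with rfl | h
    · rw [hpair_self, div_self (rfact_ne_zero b), noethSingle_self]
    · rw [hpair_ne h.symm, zero_div, noethSingle_of_ne h]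
  have hcomp : combine (isTriangular_powerCoeff hP) ∘ₗ combine hd = LinearMap.id := by
    rw [← sub_eq_zero]
    ext c x
    let A : Noeth E K →ₗ[K] K :=
      { toFun := fun c => (combine (isTriangular_powerCoeff hP) (combine hd c) : E → K) x -
          (c : E → K) x
        map_add' := fun c c' => by
          simp only [map_add, Submodule.coe_add, Pi.add_apply]; ring
        map_smul' := fun r c => by
          simp only [map_smul, Submodule.coe_smul, Pi.smul_apply, smul_eq_mul,
            RingHom.id_apply]; ring }
    have hA : A = 0 := by
      apply noeth_linearMap_eq_zero
      · refine ⟨x, fun c hc => ?_⟩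
        change (combine (isTriangular_powerCoeff hP) (combine hd c) : E → K) x - (c : E → K) x = 0
        rw [combine_eq_zero_above _ (combine_eq_zero_above hd hc) x le_rfl, hc x le_rfl, sub_zero]
      · intro a
        change (combine (isTriangular_powerCoeff hP) (combine hd (noethSingle K a)) : E → K) x -
          (noethSingle K a : E → K) x = 0
        rw [combine_noethSingle, h1, sub_self]
    exact LinearMap.congr_fun hA c
  refine ⟨d, hd, hpd, hc, h1, fun a => ?_, fun b => ?_⟩
  -- The composite in the other order is the identity as well: `hcomp` gives a right inverse of an
  -- injective map, which is then two-sided.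
  · apply combine_injective (isTriangular_powerCoeff hP)
    rw [← LinearMap.comp_apply, hcomp, LinearMap.id_apply, combine_noethSingle]
  · apply artinCoeff_injective
    funext a
    change pair (artinCoeff (P b)) (d a : E → K) / rfact K a = _
    rcases eq_or_ne a b with rfl | h
    · rw [hpair_self, div_self (rfact_ne_zero a), artinCoeff_dPow_self]
    · rw [hpair_ne h, zero_div, artinCoeff_dPow_of_ne h]

/-- The adjoint attached to a sequence associated with a delta operator is multiplicative. -/
theorem transpose_mul_of_inverse {P : E → Artin E K} (hP : IsPowerFamily P) {d : E → Noeth E K}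
    (hd : IsTriangular d)
    (h₁ : ∀ a, combine (isTriangular_powerCoeff hP) (d a) = noethSingle K a)
    (h₂ : ∀ a, combine hd (powerCoeff hP a) = noethSingle K a) (f g : Artin E K) :
    transpose hd (f * g) = transpose hd f * transpose hd g := by
  have hG := isTriangular_powerCoeff hP
  have left (f : Artin E K) : transpose hd (transpose hG f) = f := by
    rw [← transpose_comp, transpose_eq_self _ (funext h₁)]
  have right (f : Artin E K) : transpose hG (transpose hd f) = f := by
    rw [← transpose_comp, transpose_eq_self _ (funext h₂)]
  conv_lhs => rw [← right f, ← right g]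
  rw [← transpose_powerCoeff_mul, left]

/-- A continuous operator that maps the associated sequence of one delta operator to that of
another is a transfer operator, and its adjoint maps the powers of the second to those of the
first. -/
theorem isTransfer_and_adjoint [CharZero K] (h0 : rfact K (0 : E) = 1)
    {J : Submodule K (LogExpr E K)} (hJ : ∀ α : LogOrder, α ≠ 0 → LogSpace E K α ≤ J)
    {τ : J →ₗ[K] J} (hτ : IsContinuousOp τ) {P Q : E → Artin E K} (hP : IsPowerFamily P)
    (hQ : IsPowerFamily Q) {p q : E → LogOrder → LogExpr E K} (hp : IsAssociated P p)
    (hq : IsAssociated Q q) (hpq : MapsSeq τ p q) :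
    (∃ T : Artin E K →ₗ[K] Artin E K, IsAdjoint τ T ∧ (∀ T', IsAdjoint τ T' → T' = T) ∧
      ∀ a, T (Q a) = P a) ∧ IsTransfer τ := by
  obtain ⟨d, hd, hpd, -, -, hd₂, -⟩ := hp.exists_inverse h0 hP
  obtain ⟨e, he, hqe, hec, he₁, he₂, heQ⟩ := hq.exists_inverse h0 hQ
  have hG := isTriangular_powerCoeff hP
  -- The matrix of τ: λ_a is the combination of the p_b with coefficients `powerCoeff hP a`, so τ
  -- λ_a is the same combination of the q_b.
  have hM := he.comp hG
  have hmap : MapsSeq τ (harmonicLog K) fun a α => logSeries α (combine he (powerCoeff hP a)) := by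
    intro a α hα x hx
    refine map_logSeries_combine hτ hd he hpd hqe hpq hα _ x ?_
    rw [hx, hd₂, harmonicLog_eq_logSeries]
  have hseries {α : LogOrder} (hα : LogSpace E K α ≤ J) (c : Noeth E K) (x : J)
      (hx : (x : LogExpr E K) = logSeries α c) :
      (τ x : LogExpr E K) = logSeries α (combine hM c) := by
    refine map_logSeries_combine hτ isTriangular_noethSingle hM harmonicLog_eq_logSeries
      (fun _ _ => rfl) hmap hα c x ?_
    rw [hx, combine_eq_self]
  refine ⟨⟨transpose hM, ?_, ?_, fun a => ?_⟩, hτ, _, (isRoman_iff h0).2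
    ⟨_, hM, fun _ _ => rfl, hec.comp he (isContFamily_powerCoeff hP), fun f g => ?_⟩, hmap⟩
  · rintro α hα x ⟨c, hc⟩
    rw [hseries (hJ α hα) c x hc.symm, ← hc]
    refine ⟨LinearMap.mem_range_self _ _, fun f => ?_⟩
    rw [aug_opApply h0 hα, aug_opApply h0 hα, pair_transpose]
  -- Pairing with λ_a isolates the coefficient of D^a, so the adjoint relation determines every
  -- coefficient of T' f.
  · intro T' hT'
    obtain ⟨α, hα⟩ := exists_logOrder_ne_zero
    refine LinearMap.ext fun f => artinCoeff_injective (funext fun a => ?_)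
    have hmem : logSeries α (noethSingle K a) ∈ LogSpace E K α := LinearMap.mem_range_self _ _
    have h := (hT' α hα ⟨_, hJ α hα hmem⟩ hmem).2 f
    rw [hseries (hJ α hα) (noethSingle K a) _ rfl, aug_opApply h0 hα, aug_opApply h0 hα,
      ← pair_transpose, pair_noethSingle, pair_noethSingle] at h
    exact mul_right_cancel₀ (rfact_ne_zero a) h
  · rw [transpose_comp he hG, heQ, transpose_powerCoeff_dPow]
  -- The adjoint of τ is a composite of two multiplicative maps, which is what `isRoman_iff` asks of
  -- the sequence τ λ_a.
  · rw [transpose_comp he hG, transpose_mul_of_inverse hQ he he₁ he₂, transpose_powerCoeff_mul,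
      ← transpose_comp he hG, ← transpose_comp he hG]

end PowerFamily

/-! ### Integer powers of a delta operator, and power series in an operator of positive degree. -/

section Powers

set_option linter.unusedSectionVars false

variable {E K : Type*} [CommRing E] [LinearOrder E] [IsStrictOrderedRing E] [Field K]
  [Archimedean E]

theorem IsDelta.order_eq_one {f : Artin E K} (hf : IsDelta f) :
    (f : HahnSeries E K).order = 1 := by
  have h1 := HahnSeries.order_le_of_coeff_ne_zero hf.1
  have h0 : (f : HahnSeries E K) ≠ 0 := fun h => hf.1 (by rw [h, HahnSeries.coeff_zero])
  by_contra h
  exact HahnSeries.coeff_order_eq_zero.not.2 h0 (hf.2 _ (lt_of_le_of_ne h1 h))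

theorem IsDelta.ne_zero {f : Artin E K} (hf : IsDelta f) : f ≠ 0 := by
  rintro rfl
  exact hf.1 rfl

theorem order_zpow_of_isDelta {f : Artin ℤ K} (hf : IsDelta f) (n : ℤ) :
    ((f ^ n : Artin ℤ K) : HahnSeries ℤ K).order = n := by
  have hne (n : ℤ) : ((f ^ n : Artin ℤ K) : HahnSeries ℤ K) ≠ 0 := fun h =>
    zpow_ne_zero n hf.ne_zero (Subtype.ext h)
  have hf0 : (f : HahnSeries ℤ K) ≠ 0 := fun h => hf.ne_zero (Subtype.ext h)
  -- Orders add in products over a field, so each factor f shifts the order by 1; read backwards,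
  -- the same relation covers negative n.
  have step (n : ℤ) : ((f ^ (n + 1) : Artin ℤ K) : HahnSeries ℤ K).order =
      ((f ^ n : Artin ℤ K) : HahnSeries ℤ K).order + 1 := by
    rw [zpow_add_one₀ hf.ne_zero, MulMemClass.coe_mul, HahnSeries.order_mul (hne n) hf0,
      hf.order_eq_one]
  induction n with
  | zero => rw [zpow_zero, OneMemClass.coe_one, HahnSeries.order_one]
  | succ n ih => rw [step, ih]
  | pred n ih =>
    have := step (-n - 1)
    rw [sub_add_cancel, ih] at this
    omega

theorem isPowerFamily_zpow [CharZero K] {f : Artin ℤ K} (hf : IsDelta f) :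
    IsPowerFamily fun b : ℤ => f ^ b where
  add a b := zpow_add₀ hf.ne_zero a b
  lowest b h := by
    have h' : ((f ^ b : Artin ℤ K) : HahnSeries ℤ K).coeff
        ((f ^ b : Artin ℤ K) : HahnSeries ℤ K).order = 0 := by
      rw [order_zpow_of_isDelta hf b]; exact h
    exact zpow_ne_zero b hf.ne_zero (Subtype.ext (HahnSeries.coeff_order_eq_zero.1 h'))
  below b c h := HahnSeries.coeff_eq_zero_of_lt_order (by rwa [order_zpow_of_isDelta hf b])
  finite c B := by
    refine (Set.finite_Icc B c).subset fun b hb => ⟨hb.1, ?_⟩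
    by_contra h
    exact hb.2 (HahnSeries.coeff_eq_zero_of_lt_order
      (by rw [order_zpow_of_isDelta hf b]; exact not_le.1 h))
  cont _ _ _ := trivial

theorem zero_lt_orderTop_of_coeff {w : HahnSeries E K} (hw : ∀ s ≤ 0, w.coeff s = 0) :
    0 < w.orderTop := by
  by_cases h : w = 0
  · rw [h, HahnSeries.orderTop_zero]
    exact WithTop.coe_lt_top 0
  · rw [HahnSeries.zero_lt_orderTop_iff h]
    by_contra h'
    exact HahnSeries.coeff_order_eq_zero.not.2 h (hw _ (not_lt.1 h'))

/-- By the Archimedean property n · ord w eventually exceeds B. One N serves all s ≤ B, so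
coefficients of series in w become finite sums of uniform length. -/
theorem exists_pow_coeff_eq_zero {w : HahnSeries E K} (hw : 0 < w.orderTop) (B : E) :
    ∃ N : ℕ, ∀ n ≥ N, ∀ s ≤ B, (w ^ n).coeff s = 0 := by
  by_cases h0 : w = 0
  · exact ⟨1, fun n hn s _ => by rw [h0, zero_pow (by omega), HahnSeries.coeff_zero]⟩
  · have hpos : 0 < w.order := (HahnSeries.zero_lt_orderTop_iff h0).1 hw
    obtain ⟨N, hN⟩ := Archimedean.arch B hpos
    refine ⟨N + 1, fun n hn s hs => HahnSeries.coeff_eq_zero_of_lt_order ?_⟩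
    rw [HahnSeries.order_pow]
    have h1 : (N + 1) • w.order ≤ n • w.order := nsmul_le_nsmul_left hpos.le hn
    rw [succ_nsmul] at h1
    linarith

theorem coeff_heval_eq_sum {w : HahnSeries E K} (hw : 0 < w.orderTop) {B : E} {N : ℕ}
    (hN : ∀ n ≥ N, ∀ s ≤ B, (w ^ n).coeff s = 0) (F : PowerSeries K) {s : E} (hs : s ≤ B) :
    (PowerSeries.heval w F).coeff s =
      ∑ n ∈ Finset.range N, PowerSeries.coeff n F * (w ^ n).coeff s := by
  have e (n : ℕ) : (HahnSeries.SummableFamily.powerSeriesFamily w F n).coeff s =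
      PowerSeries.coeff n F * (w ^ n).coeff s := by
    rw [HahnSeries.SummableFamily.powerSeriesFamily_of_orderTop_pos hw]
    simp
  rw [PowerSeries.coeff_heval]
  refine (finsum_congr e).trans (finsum_eq_sum_of_support_subset _ fun n hn => ?_)
  rw [Finset.coe_range, Set.mem_Iio]
  by_contra h
  exact right_ne_zero_of_mul hn (hN n (not_lt.1 h) s hs)

theorem finite_support_powers {w : HahnSeries E K} (hw : 0 < w.orderTop) (hl : LeftFinite w)
    (B : E) : {s | s ≤ B ∧ ∃ n : ℕ, (w ^ n).coeff s ≠ 0}.Finite := by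
  obtain ⟨N, hN⟩ := exists_pow_coeff_eq_zero hw B
  refine ((Finset.range N).finite_toSet.biUnion fun n _ => hl.pow n B).subset ?_
  rintro s ⟨hs, n, hn⟩
  refine Set.mem_biUnion (x := n) ?_ ⟨hs, hn⟩
  rw [Finset.coe_range, Set.mem_Iio]
  by_contra h
  exact hn (hN n (not_lt.1 h) s hs)

theorem exists_pow_coeff_ne_zero_of_heval {w : HahnSeries E K} (hw : 0 < w.orderTop)
    {F : PowerSeries K} {s : E} (h : (PowerSeries.heval w F).coeff s ≠ 0) :
    ∃ n : ℕ, (w ^ n).coeff s ≠ 0 := by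
  obtain ⟨N, hN⟩ := exists_pow_coeff_eq_zero hw s
  rw [coeff_heval_eq_sum hw hN F le_rfl] at h
  obtain ⟨n, -, hn⟩ := Finset.exists_ne_zero_of_sum_ne_zero h
  exact ⟨n, right_ne_zero_of_mul hn⟩

theorem pow_coeff_eq_zero_of_neg {w : HahnSeries E K} (hw : 0 < w.orderTop) (n : ℕ) {s : E}
    (hs : s < 0) : (w ^ n).coeff s = 0 := by
  by_cases h0 : w = 0
  · rcases Nat.eq_zero_or_pos n with rfl | hn
    · rw [pow_zero]; exact HahnSeries.coeff_single_of_ne hs.ne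
    · rw [h0, zero_pow hn.ne', HahnSeries.coeff_zero]
  · apply HahnSeries.coeff_eq_zero_of_lt_order
    rw [HahnSeries.order_pow]
    exact hs.trans_le (nsmul_nonneg ((HahnSeries.zero_lt_orderTop_iff h0).1 hw).le n)

end Powers

/-! ### Real powers of a delta operator on a chosen branch. -/

section BranchPow

theorem continuous_ring_choose (n : ℕ) : Continuous fun a : ℝ => Ring.choose (a : ℂ) n := by
  have h : Continuous fun x : ℂ => Polynomial.aeval x (descPochhammer ℤ n) :=
    (descPochhammer ℤ n).continuous_aeval
  simp only [Ring.choose_eq_smul, ← Polynomial.aeval_eq_smeval, smul_eq_mul]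
  exact continuous_const.mul (h.comp Complex.continuous_ofReal)

/-- The series `w` with `f = c D (1 + w)`. -/
noncomputable def unitPart (f : Artin ℝ ℂ) : HahnSeries ℝ ℂ :=
  (f : HahnSeries ℝ ℂ) / HahnSeries.single (f : HahnSeries ℝ ℂ).order
    (f : HahnSeries ℝ ℂ).leadingCoeff - 1

theorem leftFinite_unitPart (f : Artin ℝ ℂ) : LeftFinite (unitPart f) := by
  rw [unitPart, div_eq_mul_inv, sub_eq_add_neg]
  exact (LeftFinite.mul f.2 (leftFinite_single _ _).inv).add (leftFinite_single 0 1).neg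

theorem single_mul_one_add_unitPart {f : Artin ℝ ℂ} (hf : f ≠ 0) :
    HahnSeries.single (f : HahnSeries ℝ ℂ).order (f : HahnSeries ℝ ℂ).leadingCoeff *
      (1 + unitPart f) = f := by
  have h : (f : HahnSeries ℝ ℂ) ≠ 0 := fun h => hf (Subtype.ext h)
  rw [unitPart, add_sub_cancel]
  refine mul_div_cancel₀ _ ?_
  exact HahnSeries.single_ne_zero (HahnSeries.leadingCoeff_ne_zero.2 h)

/-- Without positive degree `PowerSeries.heval` takes a default value, so this makes the binomial
series in w the genuine one. -/
theorem zero_lt_orderTop_unitPart {f : Artin ℝ ℂ} (hf : IsDelta f) :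
    0 < (unitPart f).orderTop := by
  have h : (f : HahnSeries ℝ ℂ) ≠ 0 := fun h => hf.ne_zero (Subtype.ext h)
  have hl := HahnSeries.leadingCoeff_ne_zero.2 h
  have key (s : ℝ) : (f : HahnSeries ℝ ℂ).coeff (s + 1) = (f : HahnSeries ℝ ℂ).leadingCoeff *
      ((1 : HahnSeries ℝ ℂ).coeff s + (unitPart f).coeff s) := by
    conv_lhs => rw [← single_mul_one_add_unitPart hf.ne_zero, hf.order_eq_one]
    rw [HahnSeries.coeff_single_mul, add_sub_cancel_right, HahnSeries.coeff_add]
  refine zero_lt_orderTop_of_coeff fun s hs => ?_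
  have h1 := key s
  rcases hs.lt_or_eq with hs | rfl
  · rw [hf.2 _ (by linarith), HahnSeries.coeff_one, if_neg hs.ne, zero_add] at h1
    exact (mul_eq_zero.1 h1.symm).resolve_left hl
  · rw [zero_add, HahnSeries.coeff_one, if_pos rfl] at h1
    have h2 : (f : HahnSeries ℝ ℂ).coeff 1 = (f : HahnSeries ℝ ℂ).leadingCoeff := by
      rw [HahnSeries.leadingCoeff_eq, hf.order_eq_one]
    rw [h2] at h1
    have h3 : (f : HahnSeries ℝ ℂ).leadingCoeff * (unitPart f).coeff 0 = 0 := by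
      linear_combination -h1
    exact (mul_eq_zero.1 h3).resolve_left hl

/-- The factor `exp(a (Log c + 2πin))` of the power `f^(a;n)`. -/
noncomputable def branchFactor (f : Artin ℝ ℂ) (n : ℤ) (a : ℝ) : ℂ :=
  Complex.exp (a * (Complex.log (f : HahnSeries ℝ ℂ).leadingCoeff +
    2 * Real.pi * Complex.I * n))

theorem coe_branchPow (f : Artin ℝ ℂ) (n : ℤ) (a : ℝ) : (branchPow f n a : HahnSeries ℝ ℂ) =
    HahnSeries.single (a * (f : HahnSeries ℝ ℂ).order) (branchFactor f n a) *
      PowerSeries.heval (unitPart f) (PowerSeries.binomialSeries ℂ (a : ℂ)) := rfl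

theorem branchFactor_add (f : Artin ℝ ℂ) (n : ℤ) (a b : ℝ) :
    branchFactor f n (a + b) = branchFactor f n a * branchFactor f n b := by
  rw [branchFactor, branchFactor, branchFactor, ← Complex.exp_add, Complex.ofReal_add, add_mul]

/-- The exponential law for the scalar factor, combined with Vandermonde's identity in the form
`PowerSeries.binomialSeries_add`. -/
theorem branchPow_add (f : Artin ℝ ℂ) (n : ℤ) (a b : ℝ) :
    branchPow f n (a + b) = branchPow f n a * branchPow f n b := by
  apply Subtype.ext
  rw [MulMemClass.coe_mul, coe_branchPow, coe_branchPow, coe_branchPow, branchFactor_add,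
    Complex.ofReal_add, PowerSeries.binomialSeries_add, PowerSeries.heval_mul, add_mul,
    mul_mul_mul_comm, HahnSeries.single_mul_single]

theorem artinCoeff_branchPow {f : Artin ℝ ℂ} (hf : IsDelta f) (n : ℤ) (a c : ℝ) :
    artinCoeff (branchPow f n a) c = branchFactor f n a *
      (PowerSeries.heval (unitPart f) (PowerSeries.binomialSeries ℂ (a : ℂ))).coeff (c - a) := by
  rw [artinCoeff, coe_branchPow, HahnSeries.coeff_single_mul, hf.order_eq_one, mul_one]

/-- At exponent 1 the branch disappears, since exp(2πin) = 1, and the binomial series is 1 + X. -/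
theorem branchPow_one {f : Artin ℝ ℂ} (hf : IsDelta f) (n : ℤ) : branchPow f n 1 = f := by
  have h : (f : HahnSeries ℝ ℂ) ≠ 0 := fun h => hf.ne_zero (Subtype.ext h)
  have h1 : branchFactor f n 1 = (f : HahnSeries ℝ ℂ).leadingCoeff := by
    rw [branchFactor, Complex.ofReal_one, one_mul, Complex.exp_add,
      Complex.exp_log (HahnSeries.leadingCoeff_ne_zero.2 h), mul_comm (2 * (Real.pi : ℂ) * Complex.I),
      Complex.exp_int_mul_two_pi_mul_I, mul_one]
  have h2 : PowerSeries.binomialSeries ℂ ((1 : ℝ) : ℂ) = 1 + PowerSeries.X := by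
    have := PowerSeries.binomialSeries_nat (R := ℂ) (A := ℂ) 1
    simpa using this
  apply Subtype.ext
  rw [coe_branchPow, h1, h2, map_add, map_one,
    PowerSeries.heval_X _ (zero_lt_orderTop_unitPart hf), one_mul]
  exact single_mul_one_add_unitPart hf.ne_zero

theorem continuous_branchFactor (f : Artin ℝ ℂ) (n : ℤ) : Continuous (branchFactor f n) := by
  unfold branchFactor
  fun_prop

/-- At a fixed exponent s only finitely many powers of w contribute, with coefficients polynomial in
a. -/
theorem continuous_coeff_heval_binomialSeries {w : HahnSeries ℝ ℂ} (hw : 0 < w.orderTop) (s : ℝ) :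
    Continuous fun a : ℝ =>
      (PowerSeries.heval w (PowerSeries.binomialSeries ℂ (a : ℂ))).coeff s := by
  obtain ⟨N, hN⟩ := exists_pow_coeff_eq_zero hw s
  simp only [fun a : ℝ => coeff_heval_eq_sum hw hN (PowerSeries.binomialSeries ℂ (a : ℂ)) le_rfl,
    PowerSeries.binomialSeries_coeff, smul_eq_mul, mul_one]
  exact continuous_finsetSum _ fun k _ => (continuous_ring_choose k).mul continuous_const

theorem isPowerFamily_branchPow {f : Artin ℝ ℂ} (hf : IsDelta f) (n : ℤ) :
    IsPowerFamily (branchPow f n) := by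
  have hw := zero_lt_orderTop_unitPart hf
  have supp {a c : ℝ} (h : artinCoeff (branchPow f n a) c ≠ 0) :
      ∃ k : ℕ, (unitPart f ^ k).coeff (c - a) ≠ 0 := by
    rw [artinCoeff_branchPow hf] at h
    exact exists_pow_coeff_ne_zero_of_heval hw (right_ne_zero_of_mul h)
  refine ⟨branchPow_add f n, fun b => ?_, fun b c hc => ?_, fun c B => ?_, fun φ hφ hN => ?_⟩
  · rw [artinCoeff_branchPow hf, sub_self, PowerSeries.coeff_heval_zero,
      PowerSeries.binomialSeries_constantCoeff, mul_one]
    exact Complex.exp_ne_zero _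
  · by_contra h
    obtain ⟨k, hk⟩ := supp h
    exact hk (pow_coeff_eq_zero_of_neg hw k (by linarith))
  · refine ((finite_support_powers hw (leftFinite_unitPart f) (c - B)).image
      fun s => c - s).subset ?_
    rintro b ⟨hb, h⟩
    exact ⟨c - b, ⟨by linarith, supp h⟩, by simp⟩
  · obtain ⟨N, hN⟩ := hN
    -- For fixed b the coefficient at c is not continuous in c: it lives on the discrete set b + s
    -- with s an exponent of some power of w. Summing over s = c - b instead makes every summand
    -- continuous.
    have e : (fun c : ℝ => ∑ᶠ b, φ b * artinCoeff (branchPow f n b) c) =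
        fun c => ∑ᶠ s, φ (c - s) * artinCoeff (branchPow f n (c - s)) c := by
      funext c
      exact (finsum_comp_equiv (Equiv.subLeft c)).symm
    rw [e]
    -- Local finiteness: for x < c + 1 a nonzero term needs x - s ≥ N, hence s ≤ c + 1 - N, and s is
    -- an exponent of some power of w; only finitely many s remain.
    refine continuous_finsum (fun s => ?_) fun c => ⟨Set.Iio (c + 1), Iio_mem_nhds (by linarith),
      (finite_support_powers hw (leftFinite_unitPart f) (c + 1 - N)).subset ?_⟩
    · simp only [artinCoeff_branchPow hf, sub_sub_cancel]
      have hs : Continuous fun c : ℝ => c - s := by fun_prop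
      exact (Continuous.comp (g := φ) hφ hs).mul (((continuous_branchFactor f n).comp hs).mul
        ((continuous_coeff_heval_binomialSeries hw s).comp hs))
    · rintro s ⟨x, hx, hxc⟩
      have h1 : ¬ x - s < N := fun h => left_ne_zero_of_mul hx (hN _ h)
      have h2 := supp (right_ne_zero_of_mul hx)
      rw [sub_sub_cancel] at h2
      have h3 : x < c + 1 := hxc
      exact ⟨by linarith, h2⟩

theorem rfact_int_zero (K : Type*) [Field K] [CharZero K] : rfact K (0 : ℤ) = 1 := by
  change romanFactInt K (Int.ofNat 0) = 1
  simp [romanFactInt]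

theorem rfact_real_zero : rfact ℂ (0 : ℝ) = 1 := by
  change ((romanFactReal 0 : ℝ) : ℂ) = 1
  have h : ¬ ∃ n : ℤ, n < 0 ∧ (n : ℝ) = 0 := by
    rintro ⟨n, hn, h⟩
    exact hn.ne (Int.cast_eq_zero.1 h)
  rw [romanFactReal, if_neg h, zero_add, Real.Gamma_one, Complex.ofReal_one]

end BranchPow

theorem mainTheorem5 {K : Type*} [Field K] [CharZero K]
    (J : Submodule K (LogExpr ℤ K)) (hJ : ∀ α : LogOrder, α ≠ 0 → LogSpace ℤ K α ≤ J)
    (J' : Submodule ℂ (LogExpr ℝ ℂ)) (hJ' : ∀ α : LogOrder, α ≠ 0 → LogSpace ℝ ℂ α ≤ J') :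
    -- discrete case
    ((∀ (τ : J →ₗ[K] J) (q : ℤ → LogOrder → LogExpr ℤ K), IsTransfer τ → IsRoman q →
        ∃ r : ℤ → LogOrder → LogExpr ℤ K, IsRoman r ∧ MapsSeq τ q r) ∧
      (∀ (τ : J →ₗ[K] J) (f g : Artin ℤ K) (p q : ℤ → LogOrder → LogExpr ℤ K),
        IsContinuousOp τ → IsDelta f → IsDelta g →
        IsAssociated (fun b : ℤ => f ^ b) p → IsAssociated (fun b : ℤ => g ^ b) q →
        MapsSeq τ p q →
        (∃ T : Artin ℤ K →ₗ[K] Artin ℤ K, IsAdjoint τ T ∧ (∀ T', IsAdjoint τ T' → T' = T) ∧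
          T g = f ∧ ∀ a : ℤ, T (g ^ a) = f ^ a) ∧
        IsTransfer τ)) ∧
    -- continuous case
    ((∀ (τ : J' →ₗ[ℂ] J') (q : ℝ → LogOrder → LogExpr ℝ ℂ), IsTransfer τ → IsRoman q →
        ∃ r : ℝ → LogOrder → LogExpr ℝ ℂ, IsRoman r ∧ MapsSeq τ q r) ∧
      (∀ (τ : J' →ₗ[ℂ] J') (f g : Artin ℝ ℂ) (n m : ℤ) (p q : ℝ → LogOrder → LogExpr ℝ ℂ),
        IsContinuousOp τ → IsDelta f → IsDelta g →
        IsAssociated (branchPow f n) p → IsAssociated (branchPow g m) q →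
        MapsSeq τ p q →
        (∃ T : Artin ℝ ℂ →ₗ[ℂ] Artin ℝ ℂ, IsAdjoint τ T ∧ (∀ T', IsAdjoint τ T' → T' = T) ∧
          T g = f ∧ ∀ a : ℝ, T (branchPow g m a) = branchPow f n a) ∧
        IsTransfer τ)) := by
  refine ⟨⟨fun τ q hτ hq => hτ.exists_isRoman (rfact_int_zero K) hq, ?_⟩,
    fun τ q hτ hq => hτ.exists_isRoman rfact_real_zero hq, ?_⟩
  · intro τ f g p q hτ hf hg hp hq hpq
    obtain ⟨⟨T, hT, huniq, hpow⟩, htr⟩ := isTransfer_and_adjoint (rfact_int_zero K) hJ hτ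
      (isPowerFamily_zpow hf) (isPowerFamily_zpow hg) hp hq hpq
    refine ⟨⟨T, hT, huniq, ?_, hpow⟩, htr⟩
    -- T g = f is the case of exponent 1.
    have h := hpow 1
    simp only [zpow_one] at h
    exact h
  · intro τ f g n m p q hτ hf hg hp hq hpq
    obtain ⟨⟨T, hT, huniq, hpow⟩, htr⟩ := isTransfer_and_adjoint rfact_real_zero hJ' hτ
      (isPowerFamily_branchPow hf n) (isPowerFamily_branchPow hg m) hp hq hpq
    refine ⟨⟨T, hT, huniq, ?_, hpow⟩, htr⟩
    have h := hpow 1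
    rwa [branchPow_one hf, branchPow_one hg] at h
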